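/- **Setting.** Consider the multi-participant ARX system with $p=0$ (no output regression term): $$y_{k+1}=\sum_{i=1}^m\sum_{l=1}^{q_i} b_{i,l}\,u_{i,k+1-l}+\omega_{k+1}=\theta^T\varphi_k+\omega_{k+1},\qquad k\ge 0,$$ with $y_0=0$ and $u_{i,k}=0$ for $k<0$, where $\theta=[b_{1,1},\dots,b_{1,q_1},\dots,b_{m,1},\dots,b_{m,q_m}]^T$ and $\varphi_k=[u_{1,k},\dots,u_{1,k+1-q_1},\dots,u_{m,k},\dots,u_{m,k+1-q_m}]^T$. Participant $\mathcal P_0$ releases $\bar y_k=y_k+\eta_k$, $k\ge1$, where $\eta_k$ has the Laplace distribution with mean $0$ and scale $b_0>0$; the inputs are released without noise, $\bar u_{i,k}=u_{i,k}$ (that is, $\xi_{i,k}=0$), so the data center uses $\bar\varphi_k=\varphi_k$. With $\bar P_0=(\alpha I)^{-1}$, $\alpha>0$, and any initial value $\theta_0$, the algorithm is $$\bar a_k=(1+\bar\varphi_k^T\bar P_k\bar\varphi_k)^{-1},\quad \theta_{k+1}=\theta_k+\bar a_k\bar P_k\bar\varphi_k(\bar y_{k+1}-\bar\varphi_k^T\theta_k),\quad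 \bar P_{k+1}=\bar P_k-\bar a_k\bar P_k\bar\varphi_k\bar\varphi_k^T\bar P_k .$$ Put $\tilde\theta_k=\theta-\theta_k$. **Assumptions.** 1. The system is asymptotically stable, i.e. $1-a_1z-\dots-a_pz^p\ne0$ for $|z|\le1$ (automatic for $p=0$). 2. The $\eta_k$, $k\ge1$, are mutually independent, and jointly independent of $\{y_k\},\{u_{i,k}\},\{\omega_k\}$. 3. $\{\omega_k,\mathscr F_k\}$ is a martingale difference sequence for a nondecreasing sequence of $\sigma$-algebras $\mathscr F_k$, and for some $\beta\ge2$, $\sup_k E(|\omega_{k+1}|^\beta\mid\mathscr F_k)<\infty$ a.s. 4. $\varphi_k$ is $\mathscr F_k$-measurable for every $k\ge0$. 5. $\delta,\varepsilon>0$ and $\frac{C_1}{b_0}\delta\le\varepsilon$ with $C_1=1+\frac{\sqrt p\,c_0\lambda}{1-\lambda}$ (where $c_0>0$, $\lambda\in(0,1)$ satisfy $\|A^k\|\le c_0\lambda^k$ for all $k\in\mathbb N$, $A$ being the $p\times p$ companion matrix of the output coefficients; for $p=0$, $C_1=1$). 6. $\kappa>1$ and there is a constant $\gamma_2>0$ such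 that, almost surely, $$0<\liminf_{k\to\infty}\lambda_{\min}\!\left(\tfrac1k\bar P_k^{-1}\right)\quad\text{and}\quad\limsup_{k\to\infty}\lambda_{\max}\!\left(\tfrac1k\bar P_k^{-1}\right)<\gamma_2 .$$ **Conclusions.** (i) The algorithm is $\varepsilon$-differentially private under $\delta$-adjacency for Participant $\mathcal P_0$: for all $T_2\ge T_1\ge1$, all $x,x'\in\mathbb R^{T_1}$ with $\|x-x'\|_1\le\delta$ and every Borel set $D\subseteq\mathbb R^{T_2}$, $$\mathbb P(\mathcal M_1(x)\in D)\le e^{\varepsilon}\,\mathbb P(\mathcal M_1(x')\in D),$$ where $\mathcal M_1$ maps the sensitive outputs $y_{[1:T_1]}$ to the released $\bar y_{[1:T_2]}$, the outputs $y_{T_1+1},\dots,y_{T_2}$ being generated by the system from $y_{[1:T_1]}$ and the given inputs and system noise. (ii) $\theta_k\to\theta$ almost surely, and almost surely, as $k\to\infty$, $$\|\tilde\theta_k\|^2=\begin{cases}O\!\left(\dfrac{\ln k\,(\ln(e+\ln k))^{\kappa}}{k}\right),&\beta=2,\\[2mm] O\!\left(\dfrac{\ln k}{k}\right),&\beta>2.\end{cases}$$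 -/

import Mathlib

open MeasureTheory ProbabilityTheory Filter Topology Asymptotics
open scoped ENNReal Matrix

noncomputable section

namespace MPARX

/-! ### The system -/

/-- Coordinates of the parameter and regression vectors of orders `p, q₁, …, q_m`:
`Sum.inl j` is the coordinate of the `(j+1)`-st output coefficient and `Sum.inr ⟨i, l⟩` that of the
`(l+1)`-st coefficient of the `i`-th input. -/
abbrev Idx (p : ℕ) {m : ℕ} (q : Fin m → ℕ) : Type := Fin p ⊕ (Σ i : Fin m, Fin (q i))

/-- The value `s_{k-j}` of a signal, which is zero at negative times. -/
def past (s : ℕ → ℝ) (k j : ℕ) : ℝ := if j ≤ k then s (k - j) else 0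

/-- The regression vector
`[y_k, …, y_{k+1-p}, u_{1,k}, …, u_{1,k+1-q₁}, …, u_{m,k}, …, u_{m,k+1-q_m}]`. -/
def regressor (p : ℕ) {m : ℕ} (q : Fin m → ℕ) (y : ℕ → ℝ) (u : Fin m → ℕ → ℝ) (k : ℕ) :
    Idx p q → ℝ
  | Sum.inl j => past y k j
  | Sum.inr ⟨i, l⟩ => past (u i) k l

/-- The system output when its first `T₁` values `y_1, …, y_{T₁}` are prescribed to be `x` and all
later ones are generated by `y_{k+1} = θᵀ φ_k + w_{k+1}` (with `y_0 = 0`). -/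
def output {p m : ℕ} {q : Fin m → ℕ} (θ : Idx p q → ℝ) (u : Fin m → ℕ → ℝ) (w : ℕ → ℝ)
    {T₁ : ℕ} (x : Fin T₁ → ℝ) : ℕ → ℝ
  | 0 => 0
  | k + 1 =>
      if h : k < T₁ then x ⟨k, h⟩
      else θ ⬝ᵥ regressor p q (fun s => if _h : s ≤ k then output θ u w x s else 0) u k + w (k + 1)

theorem output_zero {p m : ℕ} {q : Fin m → ℕ} (θ : Idx p q → ℝ) (u : Fin m → ℕ → ℝ) (w : ℕ → ℝ)
    {T₁ : ℕ} (x : Fin T₁ → ℝ) : output θ u w x 0 = 0 := by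
  rw [output]

theorem output_prescribed {p m : ℕ} {q : Fin m → ℕ} (θ : Idx p q → ℝ) (u : Fin m → ℕ → ℝ)
    (w : ℕ → ℝ) {T₁ : ℕ} (x : Fin T₁ → ℝ) (k : Fin T₁) : output θ u w x (k + 1) = x k := by
  rw [output, dif_pos k.2]

theorem output_succ {p m : ℕ} {q : Fin m → ℕ} (θ : Idx p q → ℝ) (u : Fin m → ℕ → ℝ)
    (w : ℕ → ℝ) {T₁ : ℕ} (x : Fin T₁ → ℝ) {k : ℕ} (hk : T₁ ≤ k) :
    output θ u w x (k + 1) = θ ⬝ᵥ regressor p q (output θ u w x) u k + w (k + 1) := by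
  rw [output, dif_neg (not_lt.mpr hk)]
  congr 2
  funext s
  rcases s with j | ⟨i, l⟩
  · simp [regressor, past]
  · rfl

/-- Asymptotic stability: `1 - a_1 z - … - a_p z^p ≠ 0` for all complex `|z| ≤ 1`. -/
def AsymptoticallyStable {p : ℕ} (a : Fin p → ℝ) : Prop :=
  ∀ z : ℂ, ‖z‖ ≤ 1 → 1 - ∑ j : Fin p, (a j : ℂ) * z ^ ((j : ℕ) + 1) ≠ 0

/-- The companion matrix with ones above the diagonal and last row `a_p, a_{p-1}, …, a_1`. -/
def companion {p : ℕ} (a : Fin p → ℝ) : Matrix (Fin p) (Fin p) ℝ :=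
  Matrix.of fun i j =>
    if (i : ℕ) + 1 = p then a j.rev else if (j : ℕ) = (i : ℕ) + 1 then 1 else 0

/-- The operator norm of a matrix induced by the Euclidean norm. -/
def opNorm {n : ℕ} (M : Matrix (Fin n) (Fin n) ℝ) : ℝ := ‖Matrix.toEuclideanCLM (𝕜 := ℝ) M‖

/-! ### Perturbed data and the recursive least-squares algorithm -/

/-- The perturbed output `ȳ_k = y_k + η_k` for `k ≥ 1`, with `ȳ_0 = 0`. -/
def yBar (y η : ℕ → ℝ) : ℕ → ℝ
  | 0 => 0
  | k + 1 => y (k + 1) + η (k + 1)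

/-- The perturbed inputs `ū_{i,k} = u_{i,k} + ξ_{i,k}`. -/
def uBar {m : ℕ} (u ξ : Fin m → ℕ → ℝ) (i : Fin m) (k : ℕ) : ℝ := u i k + ξ i k

/-- The regression vector `φ̄_k` built from the perturbed data. -/
def phiBar (p : ℕ) {m : ℕ} (q : Fin m → ℕ) (y η : ℕ → ℝ) (u ξ : Fin m → ℕ → ℝ) (k : ℕ) :
    Idx p q → ℝ :=
  regressor p q (yBar y η) (uBar u ξ) k

section RLS

variable {ι : Type*} [Fintype ι] [DecidableEq ι]

/-- The scalar `ā = (1 + φᵀ P φ)⁻¹`. -/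
def gain (P : Matrix ι ι ℝ) (φ : ι → ℝ) : ℝ := (1 + φ ⬝ᵥ (P *ᵥ φ))⁻¹

/-- The matrices `P̄_k` of the algorithm: `P̄_0 = (α I)⁻¹` and
`P̄_{k+1} = P̄_k - ā_k P̄_k φ̄_k φ̄_kᵀ P̄_k`. -/
def rlsP (α : ℝ) (φ : ℕ → ι → ℝ) : ℕ → Matrix ι ι ℝ
  | 0 => (α • (1 : Matrix ι ι ℝ))⁻¹
  | k + 1 =>
      rlsP α φ k - gain (rlsP α φ k) (φ k) •
        (rlsP α φ k * Matrix.vecMulVec (φ k) (φ k) * rlsP α φ k)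

/-- The estimates `θ_{k+1} = θ_k + ā_k P̄_k φ̄_k (ȳ_{k+1} - φ̄_kᵀ θ_k)` of the algorithm. -/
def rlsTheta (α : ℝ) (θ₀ : ι → ℝ) (φ : ℕ → ι → ℝ) (yb : ℕ → ℝ) : ℕ → ι → ℝ
  | 0 => θ₀
  | k + 1 =>
      rlsTheta α θ₀ φ yb k +
        (gain (rlsP α φ k) (φ k) * (yb (k + 1) - φ k ⬝ᵥ rlsTheta α θ₀ φ yb k)) •
          (rlsP α φ k *ᵥ φ k)

/-- The matrix `α I + ∑_{t < k} φ̄_t φ̄_tᵀ`. -/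
def information (α : ℝ) (φ : ℕ → ι → ℝ) (k : ℕ) : Matrix ι ι ℝ :=
  α • (1 : Matrix ι ι ℝ) + ∑ t ∈ Finset.range k, Matrix.vecMulVec (φ t) (φ t)

theorem information_posDef {α : ℝ} (hα : 0 < α) (φ : ℕ → ι → ℝ) (k : ℕ) :
    (information α φ k).PosDef := by
  unfold information
  refine Matrix.PosDef.add_posSemidef (Matrix.PosDef.one.smul hα) ?_
  refine Matrix.posSemidef_sum _ fun t _ => ?_
  simpa using Matrix.posSemidef_vecMulVec_self_star (φ t)

/-- The recursion computes the inverse of `α I + ∑_{t < k} φ̄_t φ̄_tᵀ`. -/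
theorem rlsP_eq {α : ℝ} (hα : 0 < α) (φ : ℕ → ι → ℝ) (k : ℕ) :
    rlsP α φ k = (information α φ k)⁻¹ := by
  induction k with
  | zero => simp [rlsP, information]
  | succ k ih =>
    have hS := information_posDef hα φ k
    have hdet : IsUnit (information α φ k).det := hS.isUnit.map Matrix.detMonoidHom
    have hg : 0 < 1 + φ k ⬝ᵥ ((information α φ k)⁻¹ *ᵥ φ k) := by
      have := hS.inv.posSemidef.dotProduct_mulVec_nonneg (φ k)
      simp only [star_trivial] at this
      linarith
    symm
    apply Matrix.inv_eq_right_inv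
    have hs : information α φ (k + 1) = information α φ k + Matrix.vecMulVec (φ k) (φ k) := by
      simp [information, Finset.sum_range_succ, add_assoc]
    rw [hs, rlsP, ih]
    set S := information α φ k with hSdef
    set V := Matrix.vecMulVec (φ k) (φ k) with hV
    have hSS : S * S⁻¹ = 1 := Matrix.mul_nonsing_inv S hdet
    have hVV : V * S⁻¹ * V = (φ k ⬝ᵥ (S⁻¹ *ᵥ φ k)) • V := by
      rw [hV, Matrix.mul_assoc, Matrix.mul_vecMulVec, Matrix.vecMulVec_mul_vecMulVec]
      ext a b
      simp [Matrix.vecMulVec_apply]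
      ring
    have hgain : gain S⁻¹ (φ k) * (1 + φ k ⬝ᵥ (S⁻¹ *ᵥ φ k)) = 1 := inv_mul_cancel₀ hg.ne'
    have e1 : S * (S⁻¹ * V * S⁻¹) = V * S⁻¹ := by
      rw [Matrix.mul_assoc, ← Matrix.mul_assoc S, hSS, Matrix.one_mul]
    have e2 : V * (S⁻¹ * V * S⁻¹) = (φ k ⬝ᵥ (S⁻¹ *ᵥ φ k)) • (V * S⁻¹) := by
      rw [← Matrix.mul_assoc, ← Matrix.mul_assoc, hVV, Matrix.smul_mul]
    rw [Matrix.add_mul, Matrix.mul_sub, Matrix.mul_sub, Matrix.mul_smul, Matrix.mul_smul, hSS, e1,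
      e2, smul_smul]
    have : V * S⁻¹ = gain S⁻¹ (φ k) • (V * S⁻¹)
        + (gain S⁻¹ (φ k) * (φ k ⬝ᵥ (S⁻¹ *ᵥ φ k))) • (V * S⁻¹) := by
      rw [← add_smul]
      have h1 : gain S⁻¹ (φ k) + gain S⁻¹ (φ k) * (φ k ⬝ᵥ (S⁻¹ *ᵥ φ k)) = 1 := by
        rw [← hgain]; ring
      rw [h1, one_smul]
    nth_rewrite 2 [this]
    abel

/-- The smallest eigenvalue of a symmetric matrix. -/
def lamMin (M : Matrix ι ι ℝ) : ℝ := sInf (spectrum ℝ M)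

/-- The largest eigenvalue of a symmetric matrix. -/
def lamMax (M : Matrix ι ι ℝ) : ℝ := sSup (spectrum ℝ M)

end RLS

/-! ### Noise and differential privacy -/

/-- The Laplace distribution with location `c` and scale `b`. -/
def laplace (c b : ℝ) : Measure ℝ :=
  volume.withDensity fun x => ENNReal.ofReal (1 / (2 * b) * Real.exp (-(|x - c| / b)))

/-- All the added noises `η_{k+1}` and `ξ_{i,k}` as one family. -/
def addedNoise {Ω : Type*} {m : ℕ} (η : ℕ → Ω → ℝ) (ξ : Fin m → ℕ → Ω → ℝ) :
    ℕ ⊕ (Fin m × ℕ) → Ω → ℝ :=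
  Sum.elim (fun k => η (k + 1)) fun ik => ξ ik.1 ik.2

/-- The added noises `η_{k+1}`, `ξ_{i,k}` are random variables, mutually independent over all
indices, and they are jointly independent of the processes `y`, `u` and `w`. -/
structure IndependentNoise {Ω : Type*} [MeasurableSpace Ω] (μ : Measure Ω) {m : ℕ}
    (η : ℕ → Ω → ℝ) (ξ : Fin m → ℕ → Ω → ℝ)
    (y : ℕ → Ω → ℝ) (u : Fin m → ℕ → Ω → ℝ) (w : ℕ → Ω → ℝ) : Prop where
  measurable : ∀ s, Measurable (addedNoise η ξ s)
  iIndep : iIndepFun (addedNoise η ξ) μ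
  indep_system :
    Indep (⨆ s, MeasurableSpace.comap (addedNoise η ξ s) inferInstance)
      ((⨆ k, MeasurableSpace.comap (y k) inferInstance) ⊔
        (⨆ i, ⨆ k, MeasurableSpace.comap (u i k) inferInstance) ⊔
        (⨆ k, MeasurableSpace.comap (w (k + 1)) inferInstance)) μ

/-- `{w_k, ℱ_k}` is a martingale difference sequence with
`sup_k E(|w_{k+1}|^β | ℱ_k) < ∞` almost surely; the conditional moment of the nonnegative variable
`|w_{k+1}|^β` is `[0, ∞]`-valued. -/
structure MartingaleDifferenceNoise {Ω : Type*} [mΩ : MeasurableSpace Ω] (μ : Measure Ω)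
    (ℱ : Filtration ℕ mΩ) (w : ℕ → Ω → ℝ) (β : ℝ) : Prop where
  adapted : ∀ k, Measurable[ℱ (k + 1)] (w (k + 1))
  integrable : ∀ k, Integrable (w (k + 1)) μ
  condExp_eq_zero : ∀ k, μ[w (k + 1)|ℱ k] =ᵐ[μ] 0
  condMoment : ∀ᵐ ω ∂μ, (⨆ k, (μ⁻[fun ω' => ‖w (k + 1) ω'‖ₑ ^ β|ℱ k]) ω) < ∞

/-- The mechanism `M` is `ε`-differentially private under `δ`-adjacency in the distance `d`. -/
def IsDifferentiallyPrivate {X Y Ω : Type*} [MeasurableSpace Y] [MeasurableSpace Ω]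
    (μ : Measure Ω) (d : X → X → ℝ) (ε δ : ℝ) (M : X → Ω → Y) : Prop :=
  ∀ x x' : X, d x x' ≤ δ → ∀ D : Set Y, MeasurableSet D →
    μ {ω | M x ω ∈ D} ≤ ENNReal.ofReal (Real.exp ε) * μ {ω | M x' ω ∈ D}

/-- The distance `‖x - x'‖₁` on `ℝⁿ`. -/
def dist1 {n : ℕ} (x x' : Fin n → ℝ) : ℝ := ∑ i, |x i - x' i|

/-- The mechanism of the participant who owns the output: the sensitive data `y_1, …, y_{T₁}` are
mapped to the released data `ȳ_1, …, ȳ_{T₂}`, where `y_{T₁+1}, …, y_{T₂}` are generated from the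
sensitive data by the system driven by the given inputs and system noise. -/
def outputMechanism {Ω : Type*} {p m : ℕ} {q : Fin m → ℕ} (θ : Idx p q → ℝ)
    (u : Fin m → ℕ → Ω → ℝ) (w η : ℕ → Ω → ℝ) (T₁ T₂ : ℕ) (x : Fin T₁ → ℝ) (ω : Ω) :
    Fin T₂ → ℝ :=
  fun k => yBar (output θ (fun i t => u i t ω) (fun t => w t ω) x) (fun t => η t ω) (k + 1)

/-- The algorithm is `ε`-differentially private under `δ`-adjacency for the participant who owns the
output: for every length `T₁ ≥ 1` of the sensitive data and every attack duration `T₂ ≥ T₁`. -/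
def PrivateForOutput {Ω : Type*} [MeasurableSpace Ω] (μ : Measure Ω) {p m : ℕ} {q : Fin m → ℕ}
    (θ : Idx p q → ℝ) (u : Fin m → ℕ → Ω → ℝ) (w η : ℕ → Ω → ℝ) (ε δ : ℝ) : Prop :=
  ∀ T₁ T₂ : ℕ, 1 ≤ T₁ → T₁ ≤ T₂ →
    IsDifferentiallyPrivate μ dist1 ε δ (outputMechanism θ u w η T₁ T₂)

end MPARX

end

/-! Privacy. Without output regression the sensitive values never feed back into later outputs, so
the released vector is x (extended by zero) plus an exogenous part plus independent Laplace noise.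
Shifting a product of Laplace laws by c instead of c' changes its density by a factor at most exp(‖c
- c'‖₁ / b₀) (`laplace_le_smul`, `pi_le_smul_pi`), and Fubini over the exogenous part finishes
(`measure_shift_le`).

Rates. Multiplying the estimation error by S_k = αI + ∑ φ_t φ_tᵀ leaves a constant vector minus the
sums ∑ φ_t (ω_{t+1} + η_{t+1}) (`information_mulVec_error`). The excitation condition gives
λ_min(S_k) ≥ ck eventually, so only the coordinates of these sums need bounds. Both noises are
martingale differences, η for the filtration generated by the whole system and the past added noise,
and φ_t is known at time t in both filtrations.

The core is a bound for M_n = ∑_{t<n} f_t v_t in terms of A_n = e + ∑_{t<n} f_t²: almost surely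
|M_n/√A_n|^β = O(h(ln A_n)) whenever h is increasing with 1/h integrable at infinity, for 2 ≤ β ≤ 4.
Passing from A_n to A_{n+1} shrinks the normalised power by a factor at most 1 - x with x =
f_n²/A_{n+1}, which absorbs the second-order term of the increment. What remains is a martingale
term and a term O(x |v_n|^β). Since x ≤ ln A_{n+1} - ln A_n, the latter, divided by h, is paid for
by the decrease of the tail potential G of 1/h. Thus `lyapunov` is a nonnegative supermartingale and
converges. Taking h(r) = r^(b/2) with b = min(β, 4) > 2 gives M_n² = O(A_n ln A_n); for β = 2 the
choice h(r) = (e+r) ln(e+r)^κ costs the iterated logarithm. The upper excitation bound turns A_k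
into O(k). -/

noncomputable section

namespace MPARX

/-! ### Scalar inequalities for powers of order between 2 and 4 -/

theorem abs_one_add_rpow_le {β t : ℝ} (h2 : 2 ≤ β) (h4 : β ≤ 4) (ht : |t| ≤ 1) :
    |1 + t| ^ β ≤ 1 + β * t + 11 * t ^ 2 := by
  obtain ⟨ht1, ht2⟩ := abs_le.mp ht
  have h1 : (0 : ℝ) ≤ 1 + t := by linarith
  rw [abs_of_nonneg h1]
  set s := β / 2 with hs
  have hβ : β = 2 * s := by rw [hs]; ring
  have hsq : (1 + t) ^ β = (1 + (2 * t + t ^ 2)) ^ s := by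
    rw [hβ, Real.rpow_mul h1, Real.rpow_two]; congr 1; ring
  have hy : -1 ≤ 2 * t + t ^ 2 := by nlinarith [sq_nonneg (1 + t)]
  -- Bernoulli's inequality for the concave exponent s - 1 ∈ [0, 1]; this is where β ≤ 4 enters. The
  -- final 11 is 2 from s t² plus 9 from (2 + t)² ≤ 9.
  have hb : (1 + (2 * t + t ^ 2)) ^ (s - 1) ≤ 1 + (s - 1) * (2 * t + t ^ 2) :=
    rpow_one_add_le_one_add_mul_self hy (by linarith) (by linarith)
  have hm : (1 + (2 * t + t ^ 2)) ^ s =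
      (1 + (2 * t + t ^ 2)) * (1 + (2 * t + t ^ 2)) ^ (s - 1) := by
    have : s = 1 + (s - 1) := by ring
    conv_lhs => rw [this]
    rw [Real.rpow_add' (by linarith) (by linarith), Real.rpow_one]
  have hmul := mul_le_mul_of_nonneg_left hb (show 0 ≤ 1 + (2 * t + t ^ 2) by linarith)
  rw [hsq, hm]
  refine hmul.trans ?_
  have e : (1 + (2 * t + t ^ 2)) * (1 + (s - 1) * (2 * t + t ^ 2)) =
      1 + 2 * s * t + s * t ^ 2 + (s - 1) * ((2 + t) ^ 2 * t ^ 2) := by ring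
  rw [e, hβ]
  have h9 : (2 + t) ^ 2 * t ^ 2 ≤ 9 * t ^ 2 :=
    mul_le_mul_of_nonneg_right (by nlinarith) (sq_nonneg t)
  have h0 : 0 ≤ (2 + t) ^ 2 * t ^ 2 := by positivity
  have hs1 : s - 1 ≤ 1 := by linarith
  have hs2 : s ≤ 2 := by linarith
  nlinarith [mul_le_mul_of_nonneg_right hs1 h0, mul_le_mul_of_nonneg_right hs2 (sq_nonneg t)]

/-- If |z| ≤ |a|, scale the expansion of |1 + t|^β at t = z/a. Otherwise every term is of size
|z|^β, and 20 = 2⁴ + 4 covers the left side and the linear term. -/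
theorem abs_add_rpow_le {β : ℝ} (h2 : 2 ≤ β) (h4 : β ≤ 4) (a z : ℝ) :
    |a + z| ^ β ≤
      |a| ^ β + β * |a| ^ (β - 2) * a * z + 11 * |a| ^ (β - 2) * z ^ 2 + 20 * |z| ^ β := by
  have hsplit : ∀ r : ℝ, 0 < |r| → |r| ^ β = |r| ^ (β - 2) * r ^ 2 := fun r hr => by
    rw [← sq_abs r, ← Real.rpow_natCast, ← Real.rpow_add hr]; norm_num
  rcases le_or_gt |z| |a| with hza | haz
  · rcases eq_or_ne a 0 with rfl | ha
    · have hz : z = 0 := by simpa using hza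
      subst hz
      simp [Real.zero_rpow (show β ≠ 0 by linarith)]
    · have hpos : 0 < |a| := abs_pos.mpr ha
      have ht : |z / a| ≤ 1 := by rw [abs_div]; exact (div_le_one hpos).mpr hza
      have key := abs_one_add_rpow_le h2 h4 ht
      have e : |a + z| ^ β = |a| ^ β * |1 + z / a| ^ β := by
        rw [← Real.mul_rpow (abs_nonneg _) (abs_nonneg _), ← abs_mul]
        congr 2; field_simp
      have k2 := mul_le_mul_of_nonneg_left key (show 0 ≤ |a| ^ β by positivity)
      rw [e]
      refine k2.trans ?_
      have e2 : |a| ^ β * (1 + β * (z / a) + 11 * (z / a) ^ 2) =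
          |a| ^ β + β * |a| ^ (β - 2) * a * z + 11 * |a| ^ (β - 2) * z ^ 2 := by
        rw [hsplit a hpos]; field_simp
      rw [e2]
      have : 0 ≤ |z| ^ β := by positivity
      linarith
  · have hz : 0 < |z| := (abs_nonneg a).trans_lt haz
    have h1 : |a + z| ^ β ≤ 16 * |z| ^ β := by
      have : |a + z| ^ β ≤ (2 * |z|) ^ β :=
        Real.rpow_le_rpow (abs_nonneg _) ((abs_add_le a z).trans (by linarith)) (by linarith)
      rw [Real.mul_rpow (by norm_num) (abs_nonneg _)] at this
      refine this.trans (mul_le_mul_of_nonneg_right ?_ (by positivity))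
      calc (2 : ℝ) ^ β ≤ 2 ^ (4 : ℝ) := Real.rpow_le_rpow_of_exponent_le (by norm_num) h4
        _ = 16 := by norm_num
    have h3 : |β * |a| ^ (β - 2) * a * z| ≤ 4 * |z| ^ β := by
      rw [abs_mul, abs_mul, abs_mul, abs_of_nonneg (show 0 ≤ β by linarith),
        abs_of_nonneg (show 0 ≤ |a| ^ (β - 2) by positivity), hsplit z hz, ← sq_abs z]
      have : |a| ^ (β - 2) ≤ |z| ^ (β - 2) :=
        Real.rpow_le_rpow (abs_nonneg _) haz.le (by linarith)
      calc β * |a| ^ (β - 2) * |a| * |z| ≤ 4 * |z| ^ (β - 2) * |z| * |z| := by gcongr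
        _ = _ := by ring
    have h5 : 0 ≤ |a| ^ β := by positivity
    have h6 : 0 ≤ 11 * |a| ^ (β - 2) * z ^ 2 := by positivity
    linarith [neg_abs_le (β * |a| ^ (β - 2) * a * z)]

/-- A Young inequality whose coefficient of |a|^β is exactly 1, so that after multiplication by x
the contraction factor 1 - x can absorb it. The threshold 11 v² = a² produces 121 = 11 · 11. -/
theorem rpow_sub_two_mul_sq_le {β : ℝ} (h2 : 2 ≤ β) (h4 : β ≤ 4) (a v : ℝ) :
    11 * |a| ^ (β - 2) * v ^ 2 ≤ |a| ^ β + 121 * |v| ^ β := by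
  have hsplit : ∀ r : ℝ, 0 < |r| → |r| ^ β = |r| ^ (β - 2) * r ^ 2 := fun r hr => by
    rw [← sq_abs r, ← Real.rpow_natCast, ← Real.rpow_add hr]; norm_num
  have ha0 : 0 ≤ |a| ^ β := by positivity
  have hv0 : 0 ≤ |v| ^ β := by positivity
  rcases le_or_gt (11 * v ^ 2) (a ^ 2) with h | h
  · rcases eq_or_ne a 0 with rfl | ha
    · have : v ^ 2 = 0 := by nlinarith [sq_nonneg v]
      rw [this]; linarith
    · rw [hsplit a (abs_pos.mpr ha)]
      have : 0 ≤ |a| ^ (β - 2) := by positivity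
      nlinarith
  · have hv : 0 < |v| := by
      rw [abs_pos]; rintro rfl; nlinarith [sq_nonneg a]
    have h1 : |a| ^ (β - 2) ≤ 11 * |v| ^ (β - 2) := by
      have h11 : |a| ≤ √11 * |v| := by
        rw [← Real.sqrt_sq_eq_abs, ← Real.sqrt_sq_eq_abs, ← Real.sqrt_mul (by norm_num)]
        exact Real.sqrt_le_sqrt h.le
      have := Real.rpow_le_rpow (abs_nonneg _) h11 (show 0 ≤ β - 2 by linarith)
      rw [Real.mul_rpow (by positivity) (abs_nonneg _)] at this
      refine this.trans (mul_le_mul_of_nonneg_right ?_ (by positivity))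
      calc √11 ^ (β - 2) ≤ √11 ^ (2 : ℝ) := Real.rpow_le_rpow_of_exponent_le
            (Real.one_le_sqrt.mpr (by norm_num)) (by linarith)
        _ = 11 := by rw [Real.rpow_two, Real.sq_sqrt (by norm_num)]
    rw [hsplit v hv]
    nlinarith [mul_le_mul_of_nonneg_right h1 (sq_nonneg v)]

/-- One step of the normalised sum `M / √A` when `M` is increased by `f v` and `A` by `f²`. -/
theorem normalized_step_le {β : ℝ} (h2 : 2 ≤ β) (h4 : β ≤ 4) {A : ℝ} (hA : 0 < A) (M f v : ℝ) :
    |(M + f * v) / √(A + f ^ 2)| ^ β ≤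
      |M / √A| ^ β +
        β * |M / √(A + f ^ 2)| ^ (β - 2) * (M / √(A + f ^ 2)) * (f / √(A + f ^ 2)) * v +
        141 * (f ^ 2 / (A + f ^ 2)) * |v| ^ β := by
  set A' := A + f ^ 2 with hA'
  have hA'0 : 0 < A' := by positivity
  set a := M / √A' with ha
  set b := f / √A' with hb
  set x := f ^ 2 / A' with hx
  have hbx : b ^ 2 = x := by rw [hb, div_pow, Real.sq_sqrt hA'0.le]
  have hx0 : 0 ≤ x := by positivity
  have hx1 : x ≤ 1 := by rw [hx, div_le_one hA'0]; linarith
  have hsplit : (M + f * v) / √A' = a + b * v := by rw [ha, hb]; ring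
  have k1 := abs_add_rpow_le h2 h4 a (b * v)
  have k2 := mul_le_mul_of_nonneg_left (rpow_sub_two_mul_sq_le h2 h4 a v) hx0
  have k3 : |b * v| ^ β ≤ x * |v| ^ β := by
    rw [abs_mul, Real.mul_rpow (abs_nonneg _) (abs_nonneg _)]
    refine mul_le_mul_of_nonneg_right ?_ (by positivity)
    rw [← hbx, ← sq_abs, ← Real.rpow_two]
    refine Real.rpow_le_rpow_of_exponent_ge' (abs_nonneg _) ?_ (by norm_num) h2
    rw [← sq_le_one_iff₀ (abs_nonneg _), sq_abs, hbx]; exact hx1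
  -- The gain from renormalising: a = (M/√A) √(1 - x), and β ≥ 2. It pays for the second-order term
  -- because (1 + x)(1 - x) ≤ 1. The constant 141 of the remainder is 121 + 20.
  have k4 : |a| ^ β ≤ (1 - x) * |M / √A| ^ β := by
    have hratio : a = M / √A * √(1 - x) := by
      have h1x : 1 - x = A / A' := by rw [hx, hA']; field_simp; ring
      rw [h1x, Real.sqrt_div hA.le, ha]
      have := Real.sqrt_pos.mpr hA
      field_simp
    rw [hratio, abs_mul, Real.mul_rpow (abs_nonneg _) (abs_nonneg _), mul_comm]
    refine mul_le_mul_of_nonneg_right ?_ (by positivity)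
    have h1 : |√(1 - x)| ≤ 1 := by
      rw [abs_of_nonneg (Real.sqrt_nonneg _)]; exact Real.sqrt_le_one.mpr (by linarith)
    calc |√(1 - x)| ^ β ≤ |√(1 - x)| ^ (2 : ℝ) :=
          Real.rpow_le_rpow_of_exponent_ge' (abs_nonneg _) h1 (by norm_num) h2
      _ = 1 - x := by rw [Real.rpow_two, sq_abs, Real.sq_sqrt (by linarith)]
  have hM : 0 ≤ |M / √A| ^ β := by positivity
  have k5 : (1 + x) * |a| ^ β ≤ |M / √A| ^ β := by
    calc (1 + x) * |a| ^ β ≤ (1 + x) * ((1 - x) * |M / √A| ^ β) := by gcongr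
      _ = (1 - x ^ 2) * |M / √A| ^ β := by ring
      _ ≤ 1 * |M / √A| ^ β := by gcongr; nlinarith [sq_nonneg x]
      _ = _ := one_mul _
  rw [hsplit]
  have e1 : 11 * |a| ^ (β - 2) * (b * v) ^ 2 = x * (11 * |a| ^ (β - 2) * v ^ 2) := by
    rw [← hbx]; ring
  have e2 : β * |a| ^ (β - 2) * a * (b * v) = β * |a| ^ (β - 2) * a * b * v := by ring
  rw [e1, e2] at k1
  linarith

/-- Serves integrability: the linear term is dominated without any moment assumption on f, since the
normalised coefficient of v is at most 1 in absolute value. -/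
theorem abs_linear_term_le {β : ℝ} (h2 : 2 ≤ β) (h4 : β ≤ 4) {A : ℝ} (hA : 0 < A) (M f v : ℝ) :
    |β * |M / √(A + f ^ 2)| ^ (β - 2) * (M / √(A + f ^ 2)) * (f / √(A + f ^ 2)) * v| ≤
      4 * (|M / √A| ^ β + |v| ^ β) := by
  have hA'0 : 0 < A + f ^ 2 := by positivity
  have hle : |M / √(A + f ^ 2)| ≤ |M / √A| := by
    rw [abs_div, abs_div, abs_of_nonneg (Real.sqrt_nonneg _), abs_of_nonneg (Real.sqrt_nonneg _)]
    have := Real.sqrt_pos.mpr hA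
    gcongr
    nlinarith [sq_nonneg f]
  have hb : |f / √(A + f ^ 2)| ≤ 1 := by
    rw [abs_div, abs_of_nonneg (Real.sqrt_nonneg _), ← Real.sqrt_sq_eq_abs]
    exact (div_le_one (Real.sqrt_pos.mpr hA'0)).mpr (Real.sqrt_le_sqrt (by linarith))
  set a := M / √(A + f ^ 2)
  set c := max |M / √A| |v| with hc
  have hc0 : 0 ≤ c := le_max_of_le_right (abs_nonneg _)
  have hcb : c ^ β ≤ |M / √A| ^ β + |v| ^ β := by
    rcases max_choice |M / √A| |v| with h | h <;> rw [hc, h]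
    · exact le_add_of_nonneg_right (by positivity)
    · exact le_add_of_nonneg_left (by positivity)
  have hcc : c ^ (β - 2) * c * c = c ^ β := by
    rcases hc0.eq_or_lt with h | h
    · rw [← h, Real.zero_rpow (show β ≠ 0 by linarith)]; simp
    · rw [mul_assoc, ← sq, ← Real.rpow_natCast, ← Real.rpow_add h]; norm_num
  have hac : |a| ≤ c := hle.trans (le_max_left _ _)
  have hvc : |v| ≤ c := le_max_right _ _
  rw [abs_mul, abs_mul, abs_mul, abs_mul, abs_of_nonneg (show 0 ≤ β by linarith),
    abs_of_nonneg (show 0 ≤ |a| ^ (β - 2) by positivity)]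
  calc β * |a| ^ (β - 2) * |a| * |f / √(A + f ^ 2)| * |v|
      ≤ 4 * c ^ (β - 2) * c * 1 * c := by
        have := Real.rpow_le_rpow (abs_nonneg a) hac (show 0 ≤ β - 2 by linarith)
        gcongr
    _ = 4 * (c ^ (β - 2) * c * c) := by ring
    _ ≤ _ := by rw [hcc]; gcongr

/-! ### Normalised sums, growth functions and the Lyapunov functional -/

/-- The sums `∑_{t < n} f_t v_t`. -/
def transform (f v : ℕ → ℝ) (n : ℕ) : ℝ := ∑ t ∈ Finset.range n, f t * v t

/-- The sums `e + ∑_{t < n} f_t²`. -/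
def energy (f : ℕ → ℝ) (n : ℕ) : ℝ := Real.exp 1 + ∑ t ∈ Finset.range n, f t ^ 2

theorem transform_succ (f v : ℕ → ℝ) (n : ℕ) :
    transform f v (n + 1) = transform f v n + f n * v n := Finset.sum_range_succ _ _

theorem energy_succ (f : ℕ → ℝ) (n : ℕ) : energy f (n + 1) = energy f n + f n ^ 2 := by
  simp [energy, Finset.sum_range_succ, add_assoc]

theorem exp_one_le_energy (f : ℕ → ℝ) (n : ℕ) : Real.exp 1 ≤ energy f n :=
  le_add_of_nonneg_right (Finset.sum_nonneg fun _ _ => sq_nonneg _)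

theorem energy_pos (f : ℕ → ℝ) (n : ℕ) : 0 < energy f n :=
  (Real.exp_pos 1).trans_le (exp_one_le_energy f n)

theorem one_le_log_energy (f : ℕ → ℝ) (n : ℕ) : 1 ≤ Real.log (energy f n) := by
  rw [Real.le_log_iff_exp_le (energy_pos f n)]; exact exp_one_le_energy f n

/-- This is x ≤ -ln(1 - x) for x = f_n²/A_{n+1}, so the weights x are dominated by increments of ln
A. -/
theorem log_energy_add_le (f : ℕ → ℝ) (n : ℕ) :
    Real.log (energy f n) + f n ^ 2 / energy f (n + 1) ≤ Real.log (energy f (n + 1)) := by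
  have h := energy_pos f n
  have h' := energy_pos f (n + 1)
  have := Real.log_le_sub_one_of_pos (div_pos h h')
  rw [Real.log_div h.ne' h'.ne'] at this
  have e : energy f n / energy f (n + 1) - 1 = - (f n ^ 2 / energy f (n + 1)) := by
    rw [energy_succ] at h' ⊢; field_simp; ring
  linarith

/-- A growth function `h` on `[1, ∞)` together with a nonnegative potential `G` of `1 / h`. -/
structure IsGrowth (h G : ℝ → ℝ) : Prop where
  measurable : Measurable h
  measurable_potential : Measurable G
  one_le : ∀ r, 1 ≤ r → 1 ≤ h r
  mono : ∀ r r', 1 ≤ r → r ≤ r' → h r ≤ h r'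
  potential_nonneg : ∀ r, 1 ≤ r → 0 ≤ G r
  potential : ∀ r r', 1 ≤ r → r ≤ r' → G r' + (r' - r) / h r' ≤ G r

/-- The normalised power `|M_n / √A_n|^β / h(log A_n)` corrected by the potential. -/
def lyapunov (h G : ℝ → ℝ) (β K : ℝ) (f v : ℕ → ℝ) (n : ℕ) : ℝ :=
  |transform f v n / √(energy f n)| ^ β / h (Real.log (energy f n)) +
    K * G (Real.log (energy f n))

/-- The coefficient of `v_n` in the one step bound for `lyapunov`. -/
def linCoeff (h : ℝ → ℝ) (β : ℝ) (f v : ℕ → ℝ) (n : ℕ) : ℝ :=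
  β * |transform f v n / √(energy f n + f n ^ 2)| ^ (β - 2) *
    (transform f v n / √(energy f n + f n ^ 2)) * (f n / √(energy f n + f n ^ 2)) /
    h (Real.log (energy f (n + 1)))

/-- The coefficient of `|v_n|^β` in the one step bound for `lyapunov`. -/
def powCoeff (h : ℝ → ℝ) (f : ℕ → ℝ) (n : ℕ) : ℝ :=
  141 * (f n ^ 2 / energy f (n + 1)) / h (Real.log (energy f (n + 1)))

theorem one_le_growth_log_energy {h G : ℝ → ℝ} (hG : IsGrowth h G) (f : ℕ → ℝ) (n : ℕ)
    : 1 ≤ h (Real.log (energy f n)) :=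
  hG.one_le _ (one_le_log_energy f n)

theorem powCoeff_mem {h G : ℝ → ℝ} (hG : IsGrowth h G) (f : ℕ → ℝ) (n : ℕ)
    : powCoeff h f n ∈ Set.Icc (0 : ℝ) 141 := by
  have h1 := one_le_growth_log_energy hG f (n + 1)
  have h3 := energy_pos f (n + 1)
  have hx : f n ^ 2 / energy f (n + 1) ≤ 1 := by
    rw [div_le_one h3, energy_succ]; linarith [energy_pos f n]
  have hx0 : 0 ≤ f n ^ 2 / energy f (n + 1) := by positivity
  constructor
  · unfold powCoeff; positivity
  · unfold powCoeff
    rw [div_le_iff₀ (by linarith)]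
    linarith

theorem abs_linCoeff_mul_le {h G : ℝ → ℝ} (hG : IsGrowth h G) {β : ℝ} (h2 : 2 ≤ β) (h4 : β ≤ 4)
    (f v : ℕ → ℝ) (n : ℕ) :
    |linCoeff h β f v n * v n| ≤
      4 * (|transform f v n / √(energy f n)| ^ β + |v n| ^ β) := by
  have h1 := one_le_growth_log_energy hG f (n + 1)
  have key := abs_linear_term_le h2 h4 (energy_pos f n) (transform f v n) (f n) (v n)
  unfold linCoeff
  rw [div_mul_eq_mul_div, abs_div, abs_of_pos (show 0 < h (Real.log (energy f (n + 1))) by linarith)]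
  exact (div_le_self (abs_nonneg _) h1).trans key

theorem abs_normalized_succ_le {β : ℝ} (h2 : 2 ≤ β) (h4 : β ≤ 4)
    (f v : ℕ → ℝ) (n : ℕ) :
    |transform f v (n + 1) / √(energy f (n + 1))| ^ β ≤
      5 * |transform f v n / √(energy f n)| ^ β + 145 * |v n| ^ β := by
  have key := abs_linear_term_le h2 h4 (energy_pos f n) (transform f v n) (f n) (v n)
  have step := normalized_step_le h2 h4 (energy_pos f n) (transform f v n) (f n) (v n)
  have h3 : 0 < energy f n + f n ^ 2 := by have := energy_pos f n; positivity
  have hx : f n ^ 2 / (energy f n + f n ^ 2) ≤ 1 := by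
    rw [div_le_one h3]; linarith [energy_pos f n]
  have hv : 0 ≤ |v n| ^ β := by positivity
  rw [transform_succ, energy_succ]
  have := mul_le_mul_of_nonneg_right hx hv
  linarith [le_abs_self (β * |transform f v n / √(energy f n + f n ^ 2)| ^ (β - 2) *
    (transform f v n / √(energy f n + f n ^ 2)) * (f n / √(energy f n + f n ^ 2)) * v n)]

/-- Since ln A grows by at least x, the potential falls by at least x / h(ln A_{n+1}). With weight
141 N this yields exactly the compensator N · `powCoeff`, which cancels the conditional mean of the
last noise term when the conditional moments are at most N. -/
theorem lyapunov_succ_le {h G : ℝ → ℝ} (hG : IsGrowth h G) {β : ℝ} (h2 : 2 ≤ β) (h4 : β ≤ 4)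
    (f v : ℕ → ℝ) (n : ℕ)
    {N : ℝ} (hN : 0 ≤ N) :
    lyapunov h G β (141 * N) f v (n + 1) ≤
      lyapunov h G β (141 * N) f v n + linCoeff h β f v n * v n +
        powCoeff h f n * |v n| ^ β - N * powCoeff h f n := by
  have step := normalized_step_le h2 h4 (energy_pos f n) (transform f v n) (f n) (v n)
  rw [← transform_succ, ← energy_succ] at step
  have h1 := one_le_growth_log_energy hG f n
  have h1' := one_le_growth_log_energy hG f (n + 1)
  have hlog := log_energy_add_le f n
  have hx0 : 0 ≤ f n ^ 2 / energy f (n + 1) := by have := energy_pos f (n + 1); positivity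
  have hmono := hG.mono _ (Real.log (energy f (n + 1))) (one_le_log_energy f n) (by linarith)
  have hpot := hG.potential _ (Real.log (energy f (n + 1))) (one_le_log_energy f n) (by linarith)
  unfold lyapunov linCoeff powCoeff
  rw [← energy_succ]
  set H := h (Real.log (energy f n))
  set H' := h (Real.log (energy f (n + 1)))
  set x := f n ^ 2 / energy f (n + 1)
  have a1 := div_le_div_of_nonneg_right step (show 0 ≤ H' by linarith)
  have a2 : |transform f v n / √(energy f n)| ^ β / H' ≤
      |transform f v n / √(energy f n)| ^ β / H := by
    gcongr
  have a3 : x / H' ≤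
      (Real.log (energy f (n + 1)) - Real.log (energy f n)) / H' := by
    gcongr; linarith
  have a4 := mul_le_mul_of_nonneg_left (a3.trans (by linarith [hpot] : _ ≤
    G (Real.log (energy f n)) - G (Real.log (energy f (n + 1))))) hN
  have e : ∀ a b c d : ℝ, (a + b * v n + 141 * x * d) / H' =
      a / H' + b / H' * v n + 141 * x / H' * d := fun a b c d => by ring
  rw [e _ _ 0 _] at a1
  have e2 : N * (141 * x / H') = 141 * (N * (x / H')) := by ring
  rw [e2]
  linarith

theorem lyapunov_nonneg {h G : ℝ → ℝ} (hG : IsGrowth h G) {β : ℝ}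
    (f v : ℕ → ℝ) (n : ℕ)
    {N : ℝ} (hN : 0 ≤ N) : 0 ≤ lyapunov h G β (141 * N) f v n := by
  have h1 := one_le_growth_log_energy hG f n
  have := hG.potential_nonneg _ (one_le_log_energy f n)
  unfold lyapunov
  positivity

theorem growth_potential_le {h G : ℝ → ℝ} (hG : IsGrowth h G)
    (r : ℝ) (hr : 1 ≤ r) : G r ≤ G 1 := by
  have := hG.potential 1 r le_rfl hr
  have h1 := hG.one_le r hr
  have : 0 ≤ (r - 1) / h r := div_nonneg (by linarith) (by linarith)
  linarith

theorem measurable_abs_rpow {Ω : Type*} {m : MeasurableSpace Ω} {g : Ω → ℝ} (hg : Measurable g)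
    (r : ℝ) : Measurable fun ω => |g ω| ^ r :=
  (measurable_norm.comp hg).pow_const r

/-! ### The supermartingale argument for bounded conditional moments -/

section martingale

variable {Ω : Type*} [mΩ : MeasurableSpace Ω] {μ : Measure Ω} [IsProbabilityMeasure μ]
  {ℱ : Filtration ℕ mΩ} {f v : ℕ → Ω → ℝ}

theorem measurable_transform
    (hf : ∀ n, Measurable[ℱ n] (f n))
    (hv : ∀ n, Measurable[ℱ (n + 1)] (v n)) (n : ℕ) :
    Measurable[ℱ n] fun ω => transform (fun t => f t ω) (fun t => v t ω) n := by
  unfold transform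
  refine Finset.measurable_sum _ fun t ht => ?_
  have : t + 1 ≤ n := Finset.mem_range.mp ht
  exact ((hf t).mono (ℱ.mono (by omega)) le_rfl).mul ((hv t).mono (ℱ.mono this) le_rfl)

theorem measurable_energy
    (hf : ∀ n, Measurable[ℱ n] (f n)) (n : ℕ) : Measurable[ℱ n] fun ω => energy (fun t => f t ω) n := by
  unfold energy
  refine measurable_const.add (Finset.measurable_sum _ fun t ht => ?_)
  exact ((hf t).mono (ℱ.mono (Finset.mem_range.mp ht).le) le_rfl).pow_const 2

theorem measurable_energy_succ
    (hf : ∀ n, Measurable[ℱ n] (f n)) (n : ℕ) :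
    Measurable[ℱ n] fun ω => energy (fun t => f t ω) (n + 1) := by
  simp only [energy_succ]
  exact (measurable_energy hf n).add ((hf n).pow_const 2)

/-- A martingale transform `M_n = ∑_{t < n} f_t v_t` with uniformly bounded conditional moments of
order `β ∈ [2, 4]` satisfies `|M_n / √A_n|^β = O(h(log A_n))` with `A_n = e + ∑_{t < n} f_t²`. -/
theorem ae_exists_normalized_le_of_condExp_le
    (hf : ∀ n, Measurable[ℱ n] (f n))
    (hv : ∀ n, Measurable[ℱ (n + 1)] (v n))
    (hint : ∀ n, Integrable (v n) μ) (hzero : ∀ n, μ[v n|ℱ n] =ᵐ[μ] 0)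
    {β : ℝ} (h2 : 2 ≤ β) (h4 : β ≤ 4) (hβint : ∀ n, Integrable (fun ω => |v n ω| ^ β) μ)
    {N : ℝ} (hN : 0 ≤ N) (hmom : ∀ n, μ[fun ω => |v n ω| ^ β|ℱ n] ≤ᵐ[μ] fun _ => N)
    {h G : ℝ → ℝ} (hG : IsGrowth h G) :
    ∀ᵐ ω ∂μ, ∃ C, ∀ n,
      |transform (fun t => f t ω) (fun t => v t ω) n / √(energy (fun t => f t ω) n)| ^ β ≤
        C * h (Real.log (energy (fun t => f t ω) n)) := by
  have mT := measurable_transform hf hv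
  have mE := measurable_energy hf
  have mE' := measurable_energy_succ hf
  have mR : ∀ n, Measurable[ℱ n] fun ω =>
      |transform (fun t => f t ω) (fun t => v t ω) n / √(energy (fun t => f t ω) n)| ^ β :=
    fun n => measurable_abs_rpow ((mT n).div (mE n).sqrt) β
  have iR : ∀ n, Integrable (fun ω =>
      |transform (fun t => f t ω) (fun t => v t ω) n / √(energy (fun t => f t ω) n)| ^ β) μ := by
    -- Integrability comes by induction from the pointwise bound by the previous normalised power
    -- and |v_n|^β; nothing is assumed on the size of f.
    intro n
    induction n with
    | zero => simp [transform, Real.zero_rpow (show β ≠ 0 by linarith)]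
    | succ n ih =>
      refine Integrable.mono' ((ih.const_mul 5).add ((hβint n).const_mul 145))
        ((mR (n + 1)).mono (ℱ.le _) le_rfl).aestronglyMeasurable (ae_of_all _ fun ω => ?_)
      rw [Real.norm_of_nonneg (by positivity)]
      exact abs_normalized_succ_le h2 h4 _ _ n
  set Y : ℕ → Ω → ℝ := fun n ω => lyapunov h G β (141 * N) (fun t => f t ω) (fun t => v t ω) n
    with hY
  have mY : ∀ n, Measurable[ℱ n] (Y n) := fun n => by
    have ml := (mE n).log
    exact ((mR n).div (hG.measurable.comp ml)).add
      ((hG.measurable_potential.comp ml).const_mul _)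
  have Y0 : ∀ n ω, 0 ≤ Y n ω := fun n ω => lyapunov_nonneg hG _ _ n hN
  have iY : ∀ n, Integrable (Y n) μ := fun n => by
    refine Integrable.mono' ((iR n).add (integrable_const (141 * N * G 1)))
      ((mY n).mono (ℱ.le _) le_rfl).aestronglyMeasurable (ae_of_all _ fun ω => ?_)
    rw [Real.norm_of_nonneg (Y0 n ω)]
    refine add_le_add (div_le_self (by positivity) (one_le_growth_log_energy hG _ n)) ?_
    exact mul_le_mul_of_nonneg_left (growth_potential_le hG _ (one_le_log_energy _ n))
      (by positivity)
  set L : ℕ → Ω → ℝ := fun n ω => linCoeff h β (fun t => f t ω) (fun t => v t ω) n with hL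
  set Q : ℕ → Ω → ℝ := fun n ω => powCoeff h (fun t => f t ω) n with hQ
  have mL : ∀ n, Measurable[ℱ n] (L n) := fun n => by
    have m1 : Measurable[ℱ n] fun ω => √(energy (fun t => f t ω) n + f n ω ^ 2) :=
      ((mE n).add ((hf n).pow_const 2)).sqrt
    have m2 := (mT n).div m1
    exact ((((measurable_abs_rpow m2 (β - 2)).const_mul β).mul m2).mul ((hf n).div m1)).div
      (hG.measurable.comp (mE' n).log)
  have mQ : ∀ n, Measurable[ℱ n] (Q n) := fun n =>
    ((((hf n).pow_const 2).div (mE' n)).const_mul 141).div (hG.measurable.comp (mE' n).log)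
  have iLv : ∀ n, Integrable (L n * v n) μ := fun n => by
    refine Integrable.mono' (((iR n).add (hβint n)).const_mul 4)
      (((mL n).mono (ℱ.le _) le_rfl).mul ((hv n).mono (ℱ.le _) le_rfl)).aestronglyMeasurable
      (ae_of_all _ fun ω => ?_)
    exact abs_linCoeff_mul_le hG h2 h4 _ _ n
  have bQ : ∀ n, ∀ᵐ ω ∂μ, ‖Q n ω‖ ≤ 141 := fun n => ae_of_all _ fun ω => by
    have := powCoeff_mem hG (fun t => f t ω) n
    rw [Real.norm_of_nonneg this.1]; exact this.2
  have iQ : ∀ n, Integrable (Q n) μ := fun n =>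
    Integrable.of_bound ((mQ n).mono (ℱ.le _) le_rfl).aestronglyMeasurable 141 (bQ n)
  have iQv : ∀ n, Integrable (Q n * fun ω => |v n ω| ^ β) μ := fun n =>
    (hβint n).bdd_mul ((mQ n).mono (ℱ.le _) le_rfl).aestronglyMeasurable (bQ n)
  have hsuper : Supermartingale Y ℱ μ := by
    refine supermartingale_nat (fun n => (mY n).stronglyMeasurable) iY fun n => ?_
    have i1 := (iY n).add (iLv n)
    have i2 := i1.add (iQv n)
    have i3 := (iQ n).const_mul N
    have hle : Y (n + 1) ≤ᵐ[μ]
        (Y n + L n * v n + Q n * fun ω => |v n ω| ^ β) - fun ω => N * Q n ω :=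
      ae_of_all _ fun ω => lyapunov_succ_le hG h2 h4 _ _ n hN
    have c0 := condExp_mono (m := ℱ n) (iY (n + 1)) (i2.sub i3) hle
    have c1 := condExp_sub i2 i3 (ℱ n)
    have c2 := condExp_add i1 (iQv n) (ℱ n)
    have c3 := condExp_add (iY n) (iLv n) (ℱ n)
    have c4 := condExp_mul_of_stronglyMeasurable_left (mL n).stronglyMeasurable (iLv n) (hint n)
    have c5 := condExp_mul_of_stronglyMeasurable_left (mQ n).stronglyMeasurable (iQv n) (hβint n)
    have c6 := condExp_of_stronglyMeasurable (ℱ.le n) (mY n).stronglyMeasurable (iY n)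
    have c7 := condExp_of_stronglyMeasurable (ℱ.le n) ((mQ n).const_mul N).stronglyMeasurable i3
    filter_upwards [c0, c1, c2, c3, c4, c5, hzero n, hmom n] with ω d0 d1 d2 d3 d4 d5 d6 d7
    rw [d1, Pi.sub_apply, d2, Pi.add_apply, d3, Pi.add_apply, d4, d5, c6, c7, Pi.mul_apply,
      Pi.mul_apply, d6] at d0
    have := mul_le_mul_of_nonneg_left d7 (powCoeff_mem hG (fun t => f t ω) n).1
    simp only [Pi.zero_apply, mul_zero, add_zero] at d0
    have e : Q n ω = powCoeff h (fun t => f t ω) n := rfl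
    rw [← e] at this
    linarith
  -- For a nonnegative supermartingale the L¹ norm is the mean, hence at most E Y_0; this lets the
  -- submartingale convergence theorem apply to -Y.
  have hbdd : ∀ n, eLpNorm ((-Y) n) 1 μ ≤ (Real.toNNReal (∫ ω, Y 0 ω ∂μ) : ℝ≥0∞) := fun n => by
    rw [Pi.neg_apply, eLpNorm_neg, eLpNorm_one_eq_lintegral_enorm,
      ← ofReal_integral_norm_eq_lintegral_enorm (iY n)]
    refine ENNReal.ofReal_le_ofReal ?_
    have := hsuper.setIntegral_le (Nat.zero_le n) MeasurableSet.univ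
    simp only [setIntegral_univ] at this
    simpa only [Real.norm_of_nonneg (Y0 n _)] using this
  filter_upwards [hsuper.neg.exists_ae_tendsto_of_bdd hbdd] with ω ⟨c, hc⟩
  obtain ⟨B, hB⟩ := hc.bddBelow_range
  refine ⟨-B, fun n => ?_⟩
  have h1 := one_le_growth_log_energy hG (fun t => f t ω) n
  have hBn : B ≤ -Y n ω := hB ⟨n, rfl⟩
  have hYn : Y n ω = |transform (fun t => f t ω) (fun t => v t ω) n /
      √(energy (fun t => f t ω) n)| ^ β / h (Real.log (energy (fun t => f t ω) n)) +
        141 * N * G (Real.log (energy (fun t => f t ω) n)) := rfl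
  have hg := mul_nonneg (show 0 ≤ 141 * N by positivity)
    (hG.potential_nonneg _ (one_le_log_energy (fun t => f t ω) n))
  rw [← div_le_iff₀ (by linarith)]
  linarith

end martingale

/-! ### Truncation to random moment bounds -/

theorem condLExp_indicator {Ω : Type*} {m mΩ : MeasurableSpace Ω} (hm : m ≤ mΩ) (μ : Measure Ω)
    [IsFiniteMeasure μ] (X : Ω → ℝ≥0∞) {E : Set Ω} (hE : MeasurableSet[m] E) :
    μ⁻[E.indicator X|m] =ᵐ[μ] E.indicator (μ⁻[X|m]) := by
  refine (ae_eq_condLExp (hm := hm) μ _ ((measurable_condLExp m μ X).indicator hE)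
    fun s hs => ?_).symm
  rw [lintegral_indicator (hm _ hE), lintegral_indicator (hm _ hE),
    Measure.restrict_restrict (hm _ hE), setLIntegral_condLExp hm _ _ (hE.inter hs)]

theorem rpow_le_one_add_rpow {r b β : ℝ} (hr : 0 ≤ r) (hb : 0 ≤ b) (hbβ : b ≤ β) :
    r ^ b ≤ 1 + r ^ β := by
  have h0 : 0 ≤ r ^ β := by positivity
  rcases le_total r 1 with h | h
  · linarith [Real.rpow_le_one hr h hb]
  · linarith [Real.rpow_le_rpow_of_exponent_le h hbβ]

theorem integrable_rpow_of_le {Ω : Type*} {mΩ : MeasurableSpace Ω} {μ : Measure Ω}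
    [IsFiniteMeasure μ] {g : Ω → ℝ} (hg : Measurable g) {b β : ℝ} (hb : 0 ≤ b) (hbβ : b ≤ β)
    (hint : Integrable (fun ω => |g ω| ^ β) μ) : Integrable (fun ω => |g ω| ^ b) μ := by
  refine Integrable.mono' ((integrable_const (1 : ℝ)).add hint)
    (measurable_abs_rpow hg b).aestronglyMeasurable (ae_of_all _ fun ω => ?_)
  rw [Real.norm_of_nonneg (by positivity)]
  exact rpow_le_one_add_rpow (abs_nonneg _) hb hbβ

/-- The bound of `ae_exists_normalized_le_of_condExp_le` for martingale difference noise whose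
conditional moments are almost surely bounded by a random constant. -/
theorem MartingaleDifferenceNoise.ae_exists_normalized_le {Ω : Type*} [mΩ : MeasurableSpace Ω]
    {μ : Measure Ω} [IsProbabilityMeasure μ] {ℱ : Filtration ℕ mΩ} {w : ℕ → Ω → ℝ} {β : ℝ}
    (hw : MartingaleDifferenceNoise μ ℱ w β) {f : ℕ → Ω → ℝ}
    (hf : ∀ n, Measurable[ℱ n] (f n)) {b : ℝ} (h2 : 2 ≤ b) (h4 : b ≤ 4) (hbβ : b ≤ β)
    {h G : ℝ → ℝ} (hG : IsGrowth h G) :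
    ∀ᵐ ω ∂μ, ∃ C, ∀ n,
      |transform (fun t => f t ω) (fun t => w (t + 1) ω) n / √(energy (fun t => f t ω) n)| ^ b ≤
        C * h (Real.log (energy (fun t => f t ω) n)) := by
  set c : ℕ → Ω → ℝ≥0∞ := fun k => μ⁻[fun ω' => ‖w (k + 1) ω'‖ₑ ^ β|ℱ k] with hc
  have mc : ∀ k, Measurable[ℱ k] (c k) := fun k => measurable_condLExp _ _ _
  -- Truncate w_{t+1} by the ℱ_t-event that its conditional moment is at most N. This keeps the
  -- martingale difference property and makes the moments deterministically bounded. Where the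
  -- supremum of the conditional moments is below N nothing is cut, and countably many N cover
  -- almost every point.
  have key : ∀ N : ℕ, ∀ᵐ ω ∂μ, ∃ C, ∀ n,
      |transform (fun t => f t ω)
          (fun t => {ω | c t ω ≤ N}.indicator (w (t + 1)) ω) n /
            √(energy (fun t => f t ω) n)| ^ b ≤
        C * h (Real.log (energy (fun t => f t ω) n)) := by
    intro N
    have mE : ∀ t, MeasurableSet[ℱ t] {ω | c t ω ≤ N} := fun t =>
      measurableSet_le (mc t) measurable_const
    set v : ℕ → Ω → ℝ := fun t => {ω | c t ω ≤ N}.indicator (w (t + 1)) with hv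
    have mv : ∀ t, Measurable[ℱ (t + 1)] (v t) := fun t =>
      (hw.adapted t).indicator (ℱ.mono (Nat.le_succ t) _ (mE t))
    have mv' : ∀ t, Measurable (v t) := fun t => (mv t).mono (ℱ.le _) le_rfl
    have hpow : ∀ t, (fun ω => ‖v t ω‖ₑ ^ β) =
        {ω | c t ω ≤ N}.indicator fun ω => ‖w (t + 1) ω‖ₑ ^ β := fun t => by
      funext ω
      by_cases hω : ω ∈ {ω | c t ω ≤ N}
      · simp only [hv, Set.indicator_of_mem hω]
      · simp only [hv, Set.indicator_of_notMem hω, enorm_zero]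
        exact ENNReal.zero_rpow_of_pos (by linarith)
    have hcond : ∀ t, ∀ᵐ ω ∂μ, (μ⁻[fun ω => ‖v t ω‖ₑ ^ β|ℱ t]) ω ≤ N := fun t => by
      rw [hpow t]
      filter_upwards [condLExp_indicator (ℱ.le t) μ (fun ω => ‖w (t + 1) ω‖ₑ ^ β) (mE t)] with ω hω
      rw [hω]
      by_cases hω : ω ∈ {ω | c t ω ≤ N}
      · rw [Set.indicator_of_mem hω]; exact hω
      · rw [Set.indicator_of_notMem hω]; exact zero_le
    have hfin : ∀ t, ∫⁻ ω, ‖v t ω‖ₑ ^ β ∂μ ≠ ∞ := fun t => by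
      rw [← lintegral_condLExp (ℱ.le t) μ]
      refine ((lintegral_mono_ae (hcond t)).trans_lt ?_).ne
      simp
    have hreal : ∀ t ω, (‖v t ω‖ₑ ^ β).toReal = |v t ω| ^ β := fun t ω => by
      rw [← ENNReal.toReal_rpow]; simp
    have mve : ∀ t, AEMeasurable (fun ω => ‖v t ω‖ₑ ^ β) μ := fun t =>
      ((mv' t).enorm.pow_const β).aemeasurable
    have iβ : ∀ t, Integrable (fun ω => |v t ω| ^ β) μ := fun t => by
      have := integrable_toReal_of_lintegral_ne_top (mve t) (hfin t)
      simpa only [hreal] using this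
    have ib : ∀ t, Integrable (fun ω => |v t ω| ^ b) μ := fun t =>
      integrable_rpow_of_le (mv' t) (by linarith) hbβ (iβ t)
    refine ae_exists_normalized_le_of_condExp_le hf mv
      (fun t => (hw.integrable t).indicator (ℱ.le t _ (mE t))) (fun t => ?_) h2 h4 ib
      -- Lowering the order from β to b uses r^b ≤ 1 + r^β, hence the extra 1.
      (N := 1 + N) (by positivity) (fun t => ?_) hG
    · filter_upwards [condExp_indicator (hw.integrable t) (mE t), hw.condExp_eq_zero t] with ω h1 h2
      rw [hv, h1]
      by_cases hω : ω ∈ {ω | c t ω ≤ N}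
      · rw [Set.indicator_of_mem hω, h2]
      · rw [Set.indicator_of_notMem hω]; rfl
    · have h1 := condExp_mono (m := ℱ t) (ib t) ((integrable_const (1 : ℝ)).add (iβ t))
        (ae_of_all _ fun ω => rpow_le_one_add_rpow (abs_nonneg (v t ω)) (by linarith) hbβ)
      have h2 := condExp_add (integrable_const (μ := μ) (1 : ℝ)) (iβ t) (ℱ t)
      have h3 := toReal_condLExp (ℱ t) (mve t) (hfin t)
      simp only [hreal] at h3
      have h4 : μ[fun _ : Ω => (1 : ℝ)|ℱ t] = fun _ => 1 := condExp_const (ℱ.le t) 1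
      filter_upwards [h1, h2, h3, hcond t] with ω e1 e2 e3 e4
      rw [e2, Pi.add_apply, h4, ← e3] at e1
      refine e1.trans (add_le_add_right ?_ 1)
      exact ENNReal.toReal_le_of_le_ofReal (by positivity) (by simpa using e4)
  filter_upwards [ae_all_iff.mpr key, hw.condMoment] with ω hkey hsup
  obtain ⟨N, hN⟩ := ENNReal.exists_nat_gt hsup.ne
  have hmem : ∀ t, ω ∈ {ω | c t ω ≤ N} := fun t =>
    (le_iSup (fun k => c k ω) t).trans hN.le
  have := hkey N
  simpa only [Set.indicator_of_mem (hmem _)] using this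

/-- Intersections t ∩ u form a π-system generating m₃ ⊔ m₂, and the product formula on it follows
from the two hypotheses. It is meant for m₁ the current added noise, m₂ the past added noise and m₃
the system. -/
theorem indep_sup_right {Ω : Type*} {m₁ m₂ m₃ mΩ : MeasurableSpace Ω} {μ : Measure Ω}
    [IsProbabilityMeasure μ] (h₁ : m₁ ≤ mΩ) (h₂ : m₂ ≤ mΩ) (h₃ : m₃ ≤ mΩ)
    (h12 : Indep m₁ m₂ μ) (h123 : Indep (m₁ ⊔ m₂) m₃ μ) : Indep m₁ (m₃ ⊔ m₂) μ := by
  set p : Set (Set Ω) := {s | ∃ t u, MeasurableSet[m₃] t ∧ MeasurableSet[m₂] u ∧ t ∩ u = s} with hp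
  have hgen : m₃ ⊔ m₂ = MeasurableSpace.generateFrom p := by
    refine le_antisymm (sup_le (fun s hs => ?_) fun s hs => ?_)
      (MeasurableSpace.generateFrom_le ?_)
    · exact MeasurableSpace.measurableSet_generateFrom
        ⟨s, Set.univ, hs, MeasurableSet.univ, Set.inter_univ s⟩
    · exact MeasurableSpace.measurableSet_generateFrom
        ⟨Set.univ, s, MeasurableSet.univ, hs, Set.univ_inter s⟩
    · rintro _ ⟨t, u, ht, hu, rfl⟩
      exact MeasurableSet.inter ((le_sup_left : m₃ ≤ m₃ ⊔ m₂) _ ht)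
        ((le_sup_right : m₂ ≤ m₃ ⊔ m₂) _ hu)
  rw [hgen, ← @MeasurableSpace.generateFrom_measurableSet Ω m₁]
  refine IndepSets.indep' (fun s hs => h₁ _ hs) ?_ (@MeasurableSpace.isPiSystem_measurableSet Ω m₁)
    ?_ ?_
  · rintro _ ⟨t, u, ht, hu, rfl⟩
    exact (h₃ _ ht).inter (h₂ _ hu)
  · rintro _ ⟨t, u, ht, hu, rfl⟩ _ ⟨t', u', ht', hu', rfl⟩ -
    exact ⟨t ∩ t', u ∩ u', ht.inter ht', hu.inter hu', by
      rw [Set.inter_inter_inter_comm]⟩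
  · rw [IndepSets_iff]
    rintro s _ hs ⟨t, u, ht, hu, rfl⟩
    rw [Indep_iff] at h12 h123
    have hsu : MeasurableSet[m₁ ⊔ m₂] (s ∩ u) := MeasurableSet.inter
      ((le_sup_left : m₁ ≤ m₁ ⊔ m₂) _ hs) ((le_sup_right : m₂ ≤ m₁ ⊔ m₂) _ hu)
    have e1 := h123 _ _ hsu ht
    have e2 := h123 _ _ ((le_sup_right : m₂ ≤ m₁ ⊔ m₂) _ hu) ht
    have e3 := h12 _ _ hs hu
    have e : s ∩ (t ∩ u) = s ∩ u ∩ t := by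
      rw [Set.inter_comm t u, Set.inter_assoc]
    rw [e, e1, e3, Set.inter_comm t u, e2, mul_assoc]

/-! ### Growth functions -/

/-- By the mean value theorem the drop of G on [r, r'] is (r' - r)/h(c) for some c < r', and h is
monotone. -/
theorem IsGrowth.of_hasDerivAt {h G : ℝ → ℝ} (hm : Measurable h) (hGm : Measurable G)
    (hone : ∀ r, 1 ≤ r → 1 ≤ h r) (hmono : ∀ r r', 1 ≤ r → r ≤ r' → h r ≤ h r')
    (hG : ∀ r, 1 ≤ r → 0 ≤ G r) (hderiv : ∀ r, 1 ≤ r → HasDerivAt G (-(h r)⁻¹) r) :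
    IsGrowth h G where
  measurable := hm
  measurable_potential := hGm
  one_le := hone
  mono := hmono
  potential_nonneg := hG
  potential r r' hr hrr' := by
    rcases hrr'.eq_or_lt with rfl | hlt
    · simp
    · obtain ⟨c, hc, hslope⟩ := exists_hasDerivAt_eq_slope G (fun r => -(h r)⁻¹) hlt
        (fun t ht => (hderiv t (hr.trans ht.1)).continuousAt.continuousWithinAt)
        (fun t ht => hderiv t (hr.trans ht.1.le))
      have hpos : 0 < r' - r := sub_pos.mpr hlt
      rw [eq_div_iff hpos.ne'] at hslope
      have h1 := hone c (hr.trans hc.1.le)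
      have h2 := hmono c r' (hr.trans hc.1.le) hc.2.le
      have h3 : (h r')⁻¹ ≤ (h c)⁻¹ := inv_anti₀ (by linarith) h2
      have h4 := mul_le_mul_of_nonneg_right h3 hpos.le
      rw [div_eq_inv_mul]
      linarith

theorem isGrowth_rpow {s : ℝ} (hs : 1 < s) :
    IsGrowth (fun r => r ^ s) fun r => r ^ (1 - s) / (s - 1) := by
  refine IsGrowth.of_hasDerivAt (measurable_id.pow_const s)
    ((measurable_id.pow_const (1 - s)).div_const _) (fun r hr => ?_) (fun r r' hr hrr' => ?_)
    (fun r hr => ?_) fun r hr => ?_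
  · exact Real.one_le_rpow hr (by linarith)
  · exact Real.rpow_le_rpow (by linarith) hrr' (by linarith)
  · have : 0 < s - 1 := by linarith
    positivity
  · have h0 : 0 < r := by linarith
    convert! ((Real.hasDerivAt_rpow_const (p := 1 - s) (Or.inl h0.ne')).div_const (s - 1)) using 1
    have : s - 1 ≠ 0 := by linarith
    rw [show 1 - s - 1 = -s by ring, Real.rpow_neg h0.le]
    field_simp
    ring

theorem one_le_log_exp_one_add {r : ℝ} (hr : 0 ≤ r) : 1 ≤ Real.log (Real.exp 1 + r) := by
  rw [Real.le_log_iff_exp_le (by positivity)]; linarith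

theorem isGrowth_mul_log_rpow {κ : ℝ} (hκ : 1 < κ) :
    IsGrowth (fun r => (Real.exp 1 + r) * Real.log (Real.exp 1 + r) ^ κ)
      fun r => Real.log (Real.exp 1 + r) ^ (1 - κ) / (κ - 1) := by
  have hl : Measurable fun r : ℝ => Real.log (Real.exp 1 + r) :=
    Real.measurable_log.comp (measurable_const.add measurable_id)
  have he := Real.exp_pos 1
  refine IsGrowth.of_hasDerivAt ((measurable_const.add measurable_id).mul (hl.pow_const κ))
    ((hl.pow_const _).div_const _) (fun r hr => ?_) (fun r r' hr hrr' => ?_)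
    (fun r hr => ?_) fun r hr => ?_
  · have h1 := one_le_log_exp_one_add (r := r) (by linarith)
    exact one_le_mul_of_one_le_of_one_le (by linarith) (Real.one_le_rpow h1 (by linarith))
  · have h1 := one_le_log_exp_one_add (r := r) (by linarith)
    have h2 : Real.log (Real.exp 1 + r) ≤ Real.log (Real.exp 1 + r') :=
      Real.log_le_log (by linarith) (by linarith)
    have h3 := Real.rpow_le_rpow (by linarith) h2 (show 0 ≤ κ by linarith)
    exact mul_le_mul (by linarith) h3 (by positivity) (by linarith)
  · have h1 := one_le_log_exp_one_add (r := r) (by linarith)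
    have : 0 < κ - 1 := by linarith
    positivity
  · have h1 := one_le_log_exp_one_add (r := r) (by linarith)
    have h0 : 0 < Real.log (Real.exp 1 + r) := by linarith
    have hr0 : 0 < Real.exp 1 + r := by linarith
    have d := ((((hasDerivAt_id r).const_add (Real.exp 1)).log hr0.ne').rpow_const
      (p := 1 - κ) (Or.inl h0.ne')).div_const (κ - 1)
    convert! d using 1
    have : κ - 1 ≠ 0 := by linarith
    simp only [id]
    rw [show 1 - κ - 1 = -κ by ring, Real.rpow_neg h0.le]
    field_simp
    ring

/-! ### The Laplace distribution -/

theorem measurable_laplace_density (c b : ℝ) :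
    Measurable fun x : ℝ => ENNReal.ofReal (1 / (2 * b) * Real.exp (-(|x - c| / b))) := by
  fun_prop

theorem integrable_comp_abs {g : ℝ → ℝ} (hg : IntegrableOn g (Set.Ioi 0)) :
    Integrable fun x => g |x| := by
  have h1 : IntegrableOn (fun x => g |x|) (Set.Ioi 0) :=
    hg.congr_fun (fun x hx => by rw [abs_of_pos hx]) measurableSet_Ioi
  have h2 : IntegrableOn (fun x => g |x|) (Set.Iic 0) := by
    rw [← Measure.map_neg_eq_self (volume : Measure ℝ)]
    let m : MeasurableEmbedding fun x : ℝ => -x := (Homeomorph.neg ℝ).measurableEmbedding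
    rw [m.integrableOn_map_iff]
    simp_rw [Function.comp_def, abs_neg, Set.neg_preimage, Set.neg_Iic, neg_zero]
    exact Iff.mpr integrableOn_Ici_iff_integrableOn_Ioi h1
  rw [← integrableOn_univ, ← Set.Iic_union_Ioi (a := (0 : ℝ))]
  exact h2.union h1

theorem integrable_abs_rpow_laplace {b β : ℝ} (hb : 0 < b) (hβ : 0 ≤ β) :
    Integrable (fun x => |x| ^ β) (laplace 0 b) := by
  unfold laplace
  rw [integrable_withDensity_iff (measurable_laplace_density 0 b)
    (ae_of_all _ fun _ => ENNReal.ofReal_lt_top)]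
  have h := (integrable_comp_abs (integrableOn_rpow_mul_exp_neg_mul_rpow (s := β) (p := 1)
    (by linarith) one_pos (inv_pos.mpr hb))).const_mul (1 / (2 * b))
  refine h.congr (ae_of_all _ fun x => ?_)
  simp only [sub_zero, Real.rpow_one]
  rw [ENNReal.toReal_ofReal (by positivity)]
  rw [show -b⁻¹ * |x| = -(|x| / b) by ring]
  ring

theorem integral_id_laplace (b : ℝ) : ∫ x, x ∂laplace 0 b = 0 := by
  unfold laplace
  rw [integral_withDensity_eq_integral_toReal_smul (measurable_laplace_density 0 b)
    (ae_of_all _ fun _ => ENNReal.ofReal_lt_top)]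
  set g : ℝ → ℝ := fun x =>
    (ENNReal.ofReal (1 / (2 * b) * Real.exp (-(|x - 0| / b)))).toReal • x with hg
  have h := integral_neg_eq_self g volume
  have h2 : ∀ x, g (-x) = - g x := fun x => by simp [hg]
  simp only [h2, integral_neg] at h
  linarith

theorem map_const_add_laplace (c b : ℝ) : (laplace 0 b).map (fun x => c + x) = laplace c b := by
  refine Measure.ext_of_lintegral _ fun g hg => ?_
  rw [lintegral_map hg (by fun_prop)]
  unfold laplace
  rw [lintegral_withDensity_eq_lintegral_mul _ (measurable_laplace_density 0 b) (by fun_prop),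
    lintegral_withDensity_eq_lintegral_mul _ (measurable_laplace_density c b) hg,
    ← lintegral_add_left_eq_self
      ((fun x : ℝ => ENNReal.ofReal (1 / (2 * b) * Real.exp (-(|x - c| / b)))) * g) c]
  simp

/-- The ratio of the densities is bounded through the triangle inequality |c - c'| + |x - c| ≥ |x -
c'|. -/
theorem laplace_le_smul {b : ℝ} (hb : 0 < b) (c c' : ℝ) :
    laplace c b ≤ ENNReal.ofReal (Real.exp (|c - c'| / b)) • laplace c' b := by
  unfold laplace
  rw [← withDensity_smul _ (measurable_laplace_density c' b)]
  refine withDensity_mono (ae_of_all _ fun x => ?_)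
  rw [Pi.smul_apply, smul_eq_mul, ← ENNReal.ofReal_mul (Real.exp_pos _).le]
  refine ENNReal.ofReal_le_ofReal ?_
  rw [mul_left_comm, ← Real.exp_add]
  refine mul_le_mul_of_nonneg_left (Real.exp_le_exp.mpr ?_) (by positivity)
  rw [← sub_eq_add_neg, ← sub_div, ← neg_div]
  gcongr
  have := abs_sub_le x c c'
  linarith

/-- `OuterMeasure.pi` is the largest outer measure bounded by the product on every box, so after
dividing by the constant a comparison on boxes suffices. -/
theorem pi_le_smul_pi {ι : Type*} [Fintype ι] {α : ι → Type*} [∀ i, MeasurableSpace (α i)]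
    (μ ν : ∀ i, Measure (α i)) [∀ i, SigmaFinite (μ i)] [∀ i, SigmaFinite (ν i)]
    (C : ι → ℝ≥0∞) (hC0 : ∀ i, C i ≠ 0) (hC : ∀ i, C i ≠ ∞) (h : ∀ i, μ i ≤ C i • ν i) :
    Measure.pi μ ≤ (∏ i, C i) • Measure.pi ν := by
  have hP0 : ∏ i, C i ≠ 0 := Finset.prod_ne_zero_iff.mpr fun i _ => hC0 i
  have hP : ∏ i, C i ≠ ∞ := ENNReal.prod_ne_top fun i _ => hC i
  have hout : ((∏ i, C i)⁻¹ • Measure.pi μ).toOuterMeasure ≤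
      OuterMeasure.pi fun i => (ν i).toOuterMeasure := by
    refine OuterMeasure.le_pi.mpr fun s _ => ?_
    change (∏ i, C i)⁻¹ * Measure.pi μ (Set.univ.pi s) ≤ _
    rw [Measure.pi_pi, ← ENNReal.div_eq_inv_mul]
    refine ENNReal.div_le_of_le_mul' ?_
    rw [← Finset.prod_mul_distrib]
    exact Finset.prod_le_prod' fun i _ => h i (s i)
  refine Measure.le_iff.mpr fun s hs => ?_
  have h1 := hout s
  change (∏ i, C i)⁻¹ * Measure.pi μ s ≤ _ at h1
  have h2 : (OuterMeasure.pi fun i => (ν i).toOuterMeasure) s = Measure.pi ν s :=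
    by rw [Measure.pi, toMeasure_apply _ _ hs]
  rw [h2, ← ENNReal.div_eq_inv_mul, ENNReal.div_le_iff' hP0 hP] at h1
  exact h1

/-- The total mass is read off from a random variable having this law, so the density need not be
integrated. -/
theorem isProbabilityMeasure_laplace {Ω : Type*} [MeasurableSpace Ω] {μ : Measure Ω}
    [IsProbabilityMeasure μ] {X : Ω → ℝ} {b : ℝ} (hX : HasLaw X (laplace 0 b) μ) :
    IsProbabilityMeasure (laplace 0 b) := by
  rw [← hX.map_eq]; exact Measure.isProbabilityMeasure_map hX.aemeasurable

theorem pi_laplace_shift_le {n : ℕ} {b : ℝ} (hb : 0 < b) [IsProbabilityMeasure (laplace 0 b)]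
    (c c' : Fin n → ℝ) {E : Set (Fin n → ℝ)} (hE : MeasurableSet E) :
    Measure.pi (fun _ : Fin n => laplace 0 b) {e | c + e ∈ E} ≤
      ENNReal.ofReal (Real.exp (dist1 c c' / b)) *
        Measure.pi (fun _ : Fin n => laplace 0 b) {e | c' + e ∈ E} := by
  have hprob : ∀ a : ℝ, IsProbabilityMeasure (laplace a b) := fun a => by
    rw [← map_const_add_laplace]; exact Measure.isProbabilityMeasure_map (by fun_prop)
  have hmap : ∀ a : Fin n → ℝ, Measure.pi (fun _ : Fin n => laplace 0 b) {e | a + e ∈ E} =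
      Measure.pi (fun i => laplace (a i) b) E := fun a => by
    have h := Measure.pi_map_pi (μ := fun _ : Fin n => laplace 0 b)
      (f := fun i x => a i + x) (fun i => by fun_prop)
    simp only [map_const_add_laplace] at h
    rw [← h, Measure.map_apply (by fun_prop) hE]
    rfl
  rw [hmap c, hmap c']
  have h := pi_le_smul_pi (fun i => laplace (c i) b) (fun i => laplace (c' i) b)
    (fun i => ENNReal.ofReal (Real.exp (|c i - c' i| / b)))
    (fun i => (ENNReal.ofReal_pos.mpr (Real.exp_pos _)).ne') (fun i => ENNReal.ofReal_ne_top)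
    (fun i => laplace_le_smul hb _ _) E
  refine h.trans_eq ?_
  rw [← ENNReal.ofReal_prod_of_nonneg fun i _ => (Real.exp_pos _).le, ← Real.exp_sum,
    ← Finset.sum_div]
  rfl

/-- Adding independent Laplace noises to `c + Z` masks the shift `c`. -/
theorem measure_shift_le {Ω : Type*} [MeasurableSpace Ω] {μ : Measure Ω} [IsProbabilityMeasure μ]
    {n : ℕ} {b : ℝ} (hb : 0 < b) [IsProbabilityMeasure (laplace 0 b)] {Z H : Ω → Fin n → ℝ}
    (hZ : Measurable Z) (hH : Measurable H) (hZH : IndepFun Z H μ)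
    (hlaw : μ.map H = Measure.pi fun _ => laplace 0 b) (c c' : Fin n → ℝ) {D : Set (Fin n → ℝ)}
    (hD : MeasurableSet D) :
    μ {ω | c + Z ω + H ω ∈ D} ≤
      ENNReal.ofReal (Real.exp (dist1 c c' / b)) * μ {ω | c' + Z ω + H ω ∈ D} := by
  have hjoint := (indepFun_iff_map_prod_eq_prod_map_map hZ.aemeasurable hH.aemeasurable).mp hZH
  have : IsProbabilityMeasure (μ.map Z) := Measure.isProbabilityMeasure_map hZ.aemeasurable
  -- By independence, condition on Z = z: the event becomes a shift of the pure Laplace product by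
  -- a, and the comparison then holds for each z separately.
  have key : ∀ a : Fin n → ℝ, μ {ω | a + Z ω + H ω ∈ D} =
      ∫⁻ z, Measure.pi (fun _ : Fin n => laplace 0 b) {e | a + e ∈ {g | z + g ∈ D}} ∂μ.map Z := by
    intro a
    have hm : MeasurableSet {p : (Fin n → ℝ) × (Fin n → ℝ) | a + p.1 + p.2 ∈ D} :=
      ((measurable_const.add measurable_fst).add measurable_snd) hD
    have h1 : μ {ω | a + Z ω + H ω ∈ D} =
        μ.map (fun ω => (Z ω, H ω)) {p | a + p.1 + p.2 ∈ D} := by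
      rw [Measure.map_apply (hZ.prodMk hH) hm]; rfl
    rw [h1, hjoint, hlaw, Measure.prod_apply hm]
    refine lintegral_congr fun z => ?_
    congr 1
    ext e
    simp only [Set.mem_preimage, Set.mem_ofPred_eq]
    rw [add_comm a z, add_assoc]
  rw [key c, key c', ← lintegral_const_mul' _ _ ENNReal.ofReal_ne_top]
  exact lintegral_mono fun z => pi_laplace_shift_le hb c c'
    ((measurable_const.add measurable_id) hD)

/-! ### The released data -/

theorem measurable_of_apply {Ω ι : Type*} {m : MeasurableSpace Ω} {g : Ω → ι → ℝ}
    (h : ∀ i, Measurable fun ω => g ω i) : Measurable g :=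
  measurable_pi_iff.mpr h

/-- The `σ`-algebra of outputs, inputs and system noise. -/
@[reducible]
def systemSigma {Ω : Type*} {m : ℕ} (y : ℕ → Ω → ℝ) (u : Fin m → ℕ → Ω → ℝ) (w : ℕ → Ω → ℝ) :
    MeasurableSpace Ω :=
  (⨆ k, MeasurableSpace.comap (y k) inferInstance) ⊔
    (⨆ i, ⨆ k, MeasurableSpace.comap (u i k) inferInstance) ⊔
    (⨆ k, MeasurableSpace.comap (w (k + 1)) inferInstance)

section system

variable {Ω : Type*} {m : ℕ} {q : Fin m → ℕ} (y : ℕ → Ω → ℝ) (u : Fin m → ℕ → Ω → ℝ)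
  (w : ℕ → Ω → ℝ)

theorem measurable_input_systemSigma (i : Fin m) (k : ℕ) :
    Measurable[systemSigma y u w] (u i k) :=
  measurable_iff_comap_le.mpr (((le_iSup (fun k => MeasurableSpace.comap (u i k) _) k).trans
    (le_iSup (fun i => ⨆ k, MeasurableSpace.comap (u i k) _) i)).trans
      (le_sup_right.trans le_sup_left))

theorem measurable_noise_systemSigma (k : ℕ) : Measurable[systemSigma y u w] (w (k + 1)) :=
  measurable_iff_comap_le.mpr ((le_iSup (fun k => MeasurableSpace.comap (w (k + 1)) _) k).trans
    le_sup_right)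

theorem measurable_regressor_systemSigma (y' : Ω → ℕ → ℝ) (k : ℕ) (j : Idx 0 q) :
    Measurable[systemSigma y u w] fun ω => regressor 0 q (y' ω) (fun i t => u i t ω) k j := by
  rcases j with j | ⟨i, l⟩
  · exact j.elim0
  · simp only [regressor, past]
    split_ifs
    · exact measurable_input_systemSigma y u w i _
    · exact measurable_const

theorem systemSigma_le [mΩ : MeasurableSpace Ω] (hy : ∀ k, Measurable (y k))
    (hu : ∀ i k, Measurable (u i k)) (hw : ∀ k, Measurable (w (k + 1))) :
    systemSigma y u w ≤ mΩ :=
  sup_le (sup_le (iSup_le fun k => (hy k).comap_le)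
    (iSup_le fun i => iSup_le fun k => (hu i k).comap_le)) (iSup_le fun k => (hw k).comap_le)

end system

theorem regressor_zero_congr {m : ℕ} {q : Fin m → ℕ} (y y' : ℕ → ℝ) (u : Fin m → ℕ → ℝ) (k : ℕ) :
    regressor 0 q y u k = regressor 0 q y' u k := by
  funext j
  rcases j with j | ⟨i, l⟩
  · exact j.elim0
  · rfl

/-- The prescribed data, extended by zero. -/
def extend {T₁ : ℕ} (T₂ : ℕ) (x : Fin T₁ → ℝ) (k : Fin T₂) : ℝ :=
  if h : (k : ℕ) < T₁ then x ⟨k, h⟩ else 0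

theorem dist1_extend_le {T₁ T₂ : ℕ} (x x' : Fin T₁ → ℝ) (h : T₁ ≤ T₂) :
    dist1 (extend T₂ x) (extend T₂ x') = dist1 x x' := by
  obtain ⟨d, rfl⟩ := Nat.exists_eq_add_of_le h
  simp [dist1, extend, Fin.sum_univ_add]

/-- The part of the later outputs that does not depend on the prescribed data. -/
def exogenous {Ω : Type*} {m : ℕ} {q : Fin m → ℕ} (θ : Idx 0 q → ℝ) (u : Fin m → ℕ → Ω → ℝ)
    (w : ℕ → Ω → ℝ) (T₁ T₂ : ℕ) (ω : Ω) (k : Fin T₂) : ℝ :=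
  if (k : ℕ) < T₁ then 0
  else θ ⬝ᵥ regressor 0 q (fun _ => 0) (fun i t => u i t ω) k + w (k + 1) ω

/-- With p = 0 the regressor contains no outputs, so the sensitive data enter only as an additive
shift of the first T₁ coordinates. -/
theorem outputMechanism_eq {Ω : Type*} {m : ℕ} {q : Fin m → ℕ} (θ : Idx 0 q → ℝ)
    (u : Fin m → ℕ → Ω → ℝ) (w η : ℕ → Ω → ℝ) (T₁ T₂ : ℕ) (x : Fin T₁ → ℝ) (ω : Ω) :
    outputMechanism θ u w η T₁ T₂ x ω =
      extend T₂ x + exogenous θ u w T₁ T₂ ω + fun k : Fin T₂ => η (k + 1) ω := by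
  funext k
  simp only [outputMechanism, yBar, Pi.add_apply, extend, exogenous]
  congr 1
  by_cases h : (k : ℕ) < T₁
  · rw [dif_pos h, if_pos h, add_zero]
    exact output_prescribed _ _ _ x ⟨k, h⟩
  · rw [dif_neg h, if_neg h, zero_add, output_succ _ _ _ _ (not_lt.mp h)]
    congr 2
    exact regressor_zero_congr _ _ _ _

theorem IndependentNoise.privateForOutput {Ω : Type*} [mΩ : MeasurableSpace Ω] {μ : Measure Ω}
    [IsProbabilityMeasure μ] {m : ℕ} {q : Fin m → ℕ} (θ : Idx 0 q → ℝ) {y : ℕ → Ω → ℝ}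
    {u : Fin m → ℕ → Ω → ℝ} {w η : ℕ → Ω → ℝ} {ξ : Fin m → ℕ → Ω → ℝ}
    (hnoise : IndependentNoise μ η ξ y u w) (hsys : systemSigma y u w ≤ mΩ)
    {b : ℝ} (hb : 0 < b) (hη : ∀ k, HasLaw (η (k + 1)) (laplace 0 b) μ)
    {δ ε : ℝ} (hscale : δ / b ≤ ε) : PrivateForOutput μ θ u w η ε δ := by
  intro T₁ T₂ _ hT x x' hx D hD
  have := isProbabilityMeasure_laplace (hη 0)
  have mη : ∀ k, Measurable (η (k + 1)) := fun k => hnoise.measurable (Sum.inl k)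
  set H : Ω → Fin T₂ → ℝ := fun ω k => η (k + 1) ω with hH
  have mH : Measurable[⨆ s, MeasurableSpace.comap (addedNoise η ξ s) inferInstance] H :=
    measurable_of_apply fun k => measurable_iff_comap_le.mpr
      (le_iSup (fun s => MeasurableSpace.comap (addedNoise η ξ s) inferInstance)
        (Sum.inl (k : ℕ)))
  have mZ : Measurable[systemSigma y u w] (exogenous θ u w T₁ T₂) := by
    refine measurable_of_apply fun k => ?_
    unfold exogenous
    by_cases h : (k : ℕ) < T₁
    · simp only [if_pos h]; exact measurable_const
    · simp only [if_neg h]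
      refine Measurable.add ?_ (measurable_noise_systemSigma y u w k)
      exact Finset.measurable_sum _ fun j _ =>
        (measurable_regressor_systemSigma y u w (fun _ _ => 0) k j).const_mul _
  have hind : IndepFun (exogenous θ u w T₁ T₂) H μ :=
    indep_of_indep_of_le_left (indep_of_indep_of_le_right hnoise.indep_system.symm
      mH.comap_le) mZ.comap_le
  have hiη : iIndepFun (fun (k : Fin T₂) => η (k + 1)) μ :=
    hnoise.iIndep.precomp (g := fun k : Fin T₂ => Sum.inl (k : ℕ))
      fun a a' h => Fin.ext (Sum.inl_injective h)
  have hlaw : μ.map H = Measure.pi fun _ => laplace 0 b := by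
    rw [hH, (iIndepFun_iff_map_fun_eq_pi_map
      (f := fun (k : Fin T₂) => η (k + 1)) fun k => (mη k).aemeasurable).mp hiη]
    congr 1
    funext k
    exact (hη k).map_eq
  have key := measure_shift_le hb (mZ.mono hsys le_rfl)
    (measurable_of_apply fun k : Fin T₂ => mη k) hind hlaw (extend T₂ x) (extend T₂ x') hD
  simp only [outputMechanism_eq]
  refine key.trans (mul_le_mul_left ?_ _)
  refine ENNReal.ofReal_le_ofReal (Real.exp_le_exp.mpr ?_)
  rw [dist1_extend_le x x' hT]
  exact (div_le_div_of_nonneg_right hx hb.le).trans hscale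

/-! ### The added noise as a martingale difference sequence -/

/-- The history of the system together with the noises `η_1, …, η_k`. -/
def noiseFiltration {Ω : Type*} [mΩ : MeasurableSpace Ω] {m : ℕ} {η : ℕ → Ω → ℝ}
    {ξ : Fin m → ℕ → Ω → ℝ} {y : ℕ → Ω → ℝ} {u : Fin m → ℕ → Ω → ℝ} {w : ℕ → Ω → ℝ}
    (hmeas : ∀ s, Measurable (addedNoise η ξ s)) (hsys : systemSigma y u w ≤ mΩ) :
    Filtration ℕ mΩ where
  -- The system at all times, future included, lies in every stage; independence of the added noise
  -- from the whole system permits this. Index j of `addedNoise` is η_{j+1}, so j < k gives η_1, …,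
  -- η_k.
  seq k := systemSigma y u w ⊔
    ⨆ s ∈ Sum.inl '' Set.Iio k, MeasurableSpace.comap (addedNoise η ξ s) inferInstance
  mono' _ _ h := sup_le_sup_left
    (biSup_mono fun _ hs => Set.image_mono (Set.Iio_subset_Iio h) hs) _
  le' _ := sup_le hsys (iSup₂_le fun s _ => (hmeas s).comap_le)

theorem IndependentNoise.martingaleDifferenceNoise {Ω : Type*} [mΩ : MeasurableSpace Ω]
    {μ : Measure Ω} [IsProbabilityMeasure μ] {m : ℕ} {y : ℕ → Ω → ℝ}
    {u : Fin m → ℕ → Ω → ℝ} {w η : ℕ → Ω → ℝ} {ξ : Fin m → ℕ → Ω → ℝ}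
    (hnoise : IndependentNoise μ η ξ y u w) (hsys : systemSigma y u w ≤ mΩ)
    {b : ℝ} (hb : 0 < b) (hη : ∀ k, HasLaw (η (k + 1)) (laplace 0 b) μ) {β : ℝ} (hβ : 0 ≤ β) :
    MartingaleDifferenceNoise μ (noiseFiltration hnoise.measurable hsys) η β := by
  have := isProbabilityMeasure_laplace (hη 0)
  have mη : ∀ k, Measurable (η (k + 1)) := fun k => hnoise.measurable (Sum.inl k)
  have hind : ∀ k, Indep (MeasurableSpace.comap (η (k + 1)) inferInstance)
      (noiseFiltration hnoise.measurable hsys k) μ := fun k => by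
    set T : Set (ℕ ⊕ (Fin m × ℕ)) := Sum.inl '' Set.Iio k
    have hle : ∀ s, MeasurableSpace.comap (addedNoise η ξ s) inferInstance ≤ mΩ :=
      fun s => (hnoise.measurable s).comap_le
    have h12 := indep_iSup_of_disjoint hle hnoise.iIndep
      (S := {Sum.inl k}) (T := T) (by
        rw [Set.disjoint_singleton_left]
        rintro ⟨j, hj, h⟩
        exact (Sum.inl_injective h ▸ hj : k < k).false)
    rw [iSup_singleton] at h12
    refine indep_sup_right (hle (Sum.inl k)) (iSup₂_le fun s _ => hle s) hsys h12 ?_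
    exact indep_of_indep_of_le_left hnoise.indep_system
      (sup_le (le_iSup (fun s => MeasurableSpace.comap (addedNoise η ξ s) inferInstance) (Sum.inl k))
        (iSup₂_le fun s _ =>
          le_iSup (fun s => MeasurableSpace.comap (addedNoise η ξ s) inferInstance) s))
  have ipow : ∀ k, Integrable (fun ω => |η (k + 1) ω| ^ β) μ := fun k => by
    have h := integrable_abs_rpow_laplace hb hβ
    rw [← (hη k).map_eq] at h
    exact h.comp_measurable (mη k)
  have iid : Integrable (fun x : ℝ => x) (laplace 0 b) := by
    have h := integrable_abs_rpow_laplace hb zero_le_one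
    simp only [Real.rpow_one] at h
    exact (integrable_norm_iff measurable_id.aestronglyMeasurable).mp h
  refine ⟨fun k => ?_, fun k => ?_, fun k => ?_, ?_⟩
  · refine measurable_iff_comap_le.mpr (le_trans ?_ le_sup_right)
    exact le_iSup₂ (f := fun s (_ : s ∈ Sum.inl '' Set.Iio (k + 1)) =>
      MeasurableSpace.comap (addedNoise η ξ s) inferInstance) (Sum.inl k)
      ⟨k, Nat.lt_succ_self k, rfl⟩
  · have h := iid
    rw [← (hη k).map_eq] at h
    exact h.comp_measurable (mη k)
  · have h := condExp_indep_eq (mη k).comap_le (Filtration.le _ k)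
      (comap_measurable (η (k + 1))).stronglyMeasurable (hind k)
    refine h.trans (ae_of_all _ fun ω => ?_)
    change ∫ ω, η (k + 1) ω ∂μ = 0
    rw [← integral_id_laplace b, ← (hη k).map_eq,
      integral_map (f := fun x : ℝ => x) (mη k).aemeasurable measurable_id.aestronglyMeasurable]
  -- By independence the conditional moment is the plain Laplace moment, the same for every k, so
  -- the supremum is finite.
  · have hk : ∀ k, ∀ᵐ ω ∂μ, (μ⁻[fun ω' => ‖η (k + 1) ω'‖ₑ ^ β|
        noiseFiltration hnoise.measurable hsys k]) ω =
          ENNReal.ofReal (∫ x, |x| ^ β ∂laplace 0 b) := fun k => by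
      have e : (fun ω' => ‖η (k + 1) ω'‖ₑ ^ β) =
          fun ω' => ENNReal.ofReal (|η (k + 1) ω'| ^ β) := by
        funext ω'
        rw [← ENNReal.ofReal_rpow_of_nonneg (abs_nonneg _) hβ, ← Real.enorm_eq_ofReal_abs]
      rw [e]
      have h1 := condLExp_ofReal (noiseFiltration hnoise.measurable hsys k) (ipow k)
        (ae_of_all _ fun ω => by positivity)
      have h2 := condExp_indep_eq (mη k).comap_le (Filtration.le _ k)
        (measurable_abs_rpow (comap_measurable (η (k + 1))) β).stronglyMeasurable (hind k)
      filter_upwards [h1, h2] with ω e1 e2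
      rw [e1, e2, ← (hη k).map_eq, integral_map (f := fun x : ℝ => |x| ^ β)
        (mη k).aemeasurable (measurable_abs_rpow measurable_id β).aestronglyMeasurable]
    filter_upwards [ae_all_iff.mpr hk] with ω hω
    simp only [hω, ciSup_const]
    exact ENNReal.ofReal_lt_top

/-! ### Linear algebra of the recursive least-squares algorithm -/

theorem information_succ {ι : Type*} [DecidableEq ι] (α : ℝ) (φ : ℕ → ι → ℝ) (k : ℕ) :
    information α φ (k + 1) = information α φ k + Matrix.vecMulVec (φ k) (φ k) := by
  simp [information, Finset.sum_range_succ, add_assoc]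

theorem information_apply_self {ι : Type*} [DecidableEq ι] (α : ℝ) (φ : ℕ → ι → ℝ) (k : ℕ) (j : ι) :
    information α φ k j j = α + ∑ t ∈ Finset.range k, φ t j ^ 2 := by
  simp [information, Matrix.sum_apply, Matrix.vecMulVec_apply, sq]

theorem vecMulVec_mulVec_self {ι : Type*} [Fintype ι] (φ x : ι → ℝ) :
    Matrix.vecMulVec φ φ *ᵥ x = (φ ⬝ᵥ x) • φ := by
  ext i
  simp [Matrix.mulVec, dotProduct, Matrix.vecMulVec_apply, Finset.mul_sum, mul_comm, mul_left_comm]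

theorem dotProduct_self_le_of_mul_le {ι : Type*} [Fintype ι] {x b : ι → ℝ} {c : ℝ} (hc : 0 < c)
    (h : c * (x ⬝ᵥ x) ≤ x ⬝ᵥ b) : x ⬝ᵥ x ≤ (b ⬝ᵥ b) / c ^ 2 := by
  have hcs : (x ⬝ᵥ b) ^ 2 ≤ (x ⬝ᵥ x) * (b ⬝ᵥ b) := by
    have := Finset.sum_mul_sq_le_sq_mul_sq Finset.univ x b
    simpa only [dotProduct, ← sq] using this
  have hx : 0 ≤ x ⬝ᵥ x := Finset.sum_nonneg fun i _ => mul_self_nonneg _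
  have hb : 0 ≤ b ⬝ᵥ b := Finset.sum_nonneg fun i _ => mul_self_nonneg _
  rcases hx.eq_or_lt with h0 | h0
  · rw [← h0]; positivity
  · rw [le_div_iff₀ (by positivity)]
    have h1 : (c * (x ⬝ᵥ x)) ^ 2 ≤ (x ⬝ᵥ x) * (b ⬝ᵥ b) :=
      (pow_le_pow_left₀ (by positivity) h 2).trans hcs
    have h2 : (x ⬝ᵥ x) * ((x ⬝ᵥ x) * c ^ 2) ≤ (x ⬝ᵥ x) * (b ⬝ᵥ b) := by
      calc _ = (c * (x ⬝ᵥ x)) ^ 2 := by ring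
        _ ≤ _ := h1
    exact le_of_mul_le_mul_left h2 h0

section algebra

variable {ι : Type*} [Fintype ι] [DecidableEq ι]

theorem isUnit_det_information {α : ℝ} (hα : 0 < α) (φ : ℕ → ι → ℝ) (k : ℕ) :
    IsUnit (information α φ k).det :=
  (information_posDef hα φ k).isUnit.map Matrix.detMonoidHom

theorem inv_rlsP {α : ℝ} (hα : 0 < α) (φ : ℕ → ι → ℝ) (k : ℕ) :
    (rlsP α φ k)⁻¹ = information α φ k := by
  rw [rlsP_eq hα, Matrix.nonsing_inv_nonsing_inv _ (isUnit_det_information hα φ k)]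

/-- The identity ā_k P_k φ_k = P_{k+1} φ_k in inverse-free form: S_{k+1} P_k φ_k = (1 + φ_kᵀ P_k
φ_k) φ_k. -/
theorem gain_smul_information_succ_mulVec {α : ℝ} (hα : 0 < α) (φ : ℕ → ι → ℝ) (k : ℕ) :
    gain (rlsP α φ k) (φ k) • (information α φ (k + 1) *ᵥ (rlsP α φ k *ᵥ φ k)) = φ k := by
  have hS := (information_posDef hα φ k).inv.posSemidef.dotProduct_mulVec_nonneg (φ k)
  simp only [star_trivial] at hS
  rw [← rlsP_eq hα] at hS
  have h1 : information α φ k *ᵥ (rlsP α φ k *ᵥ φ k) = φ k := by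
    rw [Matrix.mulVec_mulVec, rlsP_eq hα,
      Matrix.mul_nonsing_inv _ (isUnit_det_information hα φ k), Matrix.one_mulVec]
  rw [information_succ, Matrix.add_mulVec, h1, vecMulVec_mulVec_self]
  nth_rewrite 2 [← one_smul ℝ (φ k)]
  rw [← add_smul, smul_smul, gain, inv_mul_cancel₀ (by linarith), one_smul]

/-- The estimation error in terms of the equation errors `ȳ_{t+1} - φ_tᵀ θ`. -/
theorem information_mulVec_error {α : ℝ} (hα : 0 < α) (θ θ₀ : ι → ℝ) (φ : ℕ → ι → ℝ)
    (yb : ℕ → ℝ) (k : ℕ) :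
    information α φ k *ᵥ (θ - rlsTheta α θ₀ φ yb k) =
      α • (θ - θ₀) - ∑ t ∈ Finset.range k, (yb (t + 1) - φ t ⬝ᵥ θ) • φ t := by
  induction k with
  | zero => simp [information, rlsTheta, Matrix.smul_mulVec]
  | succ k ih =>
    have hg := gain_smul_information_succ_mulVec hα φ k
    rw [rlsTheta, ← sub_sub, Matrix.mulVec_sub, Matrix.mulVec_smul, mul_comm, mul_smul, hg,
      information_succ, Matrix.add_mulVec, ih, vecMulVec_mulVec_self, Finset.sum_range_succ,
      dotProduct_sub]
    module

/-- Subtracting λ_min times the identity shifts the spectrum into [0, ∞), which makes the difference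
positive semidefinite. -/
theorem lamMin_mul_le {M : Matrix ι ι ℝ} (hM : M.IsHermitian) (x : ι → ℝ) :
    lamMin M * (x ⬝ᵥ x) ≤ x ⬝ᵥ (M *ᵥ x) := by
  have hps : (M - algebraMap ℝ (Matrix ι ι ℝ) (lamMin M)).PosSemidef := by
    rw [Matrix.posSemidef_iff_isHermitian_and_spectrum_nonneg (𝕜 := ℝ)]
    refine ⟨hM.sub (Matrix.isHermitian_diagonal _), fun r hr => ?_⟩
    rw [← spectrum.sub_singleton_eq] at hr
    obtain ⟨s, hs, _, rfl, rfl⟩ := hr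
    exact sub_nonneg.mpr (csInf_le (Matrix.finite_real_spectrum).bddBelow hs)
  have h := hps.dotProduct_mulVec_nonneg x
  simp only [star_trivial, Matrix.sub_mulVec, dotProduct_sub, Algebra.algebraMap_eq_smul_one,
    Matrix.smul_mulVec, Matrix.one_mulVec, dotProduct_smul, smul_eq_mul] at h
  linarith

theorem diag_le_lamMax {M : Matrix ι ι ℝ} (hM : M.IsHermitian) (j : ι) : M j j ≤ lamMax M := by
  have hps : (algebraMap ℝ (Matrix ι ι ℝ) (lamMax M) - M).PosSemidef := by
    rw [Matrix.posSemidef_iff_isHermitian_and_spectrum_nonneg (𝕜 := ℝ)]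
    refine ⟨Matrix.IsHermitian.sub (Matrix.isHermitian_diagonal _) hM, fun r hr => ?_⟩
    rw [← spectrum.singleton_sub_eq] at hr
    obtain ⟨_, rfl, s, hs, rfl⟩ := hr
    exact sub_nonneg.mpr (le_csSup (Matrix.finite_real_spectrum).bddAbove hs)
  have h := hps.diag_nonneg (i := j)
  simp [Matrix.algebraMap_matrix_apply] at h
  exact h

theorem isHermitian_smul_information {α : ℝ} (hα : 0 < α) (φ : ℕ → ι → ℝ) (k : ℕ) (c : ℝ) :
    (c • information α φ k).IsHermitian := by
  have h := (information_posDef hα φ k).isHermitian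
  unfold Matrix.IsHermitian at h ⊢
  rw [Matrix.conjTranspose_smul, h, star_trivial]

/-- The j-th diagonal entry of S_k is α + ∑ φ_{t,j}², and it is at most λ_max(S_k). -/
theorem eventually_energy_le {α : ℝ} (hα : 0 < α) (φ : ℕ → ι → ℝ) {γ : ℝ}
    (hmax : limsup (fun k : ℕ => ((lamMax ((1 / (k : ℝ)) • information α φ k) : ℝ) : EReal)) atTop
      < (γ : EReal)) (j : ι) :
    ∃ C, ∀ᶠ k : ℕ in atTop, energy (fun t => φ t j) k ≤ C * k := by
  refine ⟨Real.exp 1 + γ, ?_⟩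
  filter_upwards [eventually_lt_of_limsup_lt hmax, eventually_ge_atTop 1] with k hk hk1
  have hk0 : (1 : ℝ) ≤ k := by exact_mod_cast hk1
  have hlt : lamMax ((1 / (k : ℝ)) • information α φ k) < γ := by exact_mod_cast hk
  have h := (diag_le_lamMax (isHermitian_smul_information hα φ k (1 / (k : ℝ))) j).trans hlt.le
  rw [Matrix.smul_apply, information_apply_self, smul_eq_mul, one_div, inv_mul_le_iff₀ (by linarith)]
    at h
  unfold energy
  have := Real.exp_pos 1
  nlinarith

/-- From λ_min(S_k) ≥ ck and Cauchy–Schwarz, the error is at most ‖S_k · error‖ / (ck), and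
`information_mulVec_error` evaluates the numerator. -/
theorem eventually_error_le {α : ℝ} (hα : 0 < α) (θ θ₀ : ι → ℝ) (φ : ℕ → ι → ℝ) (yb : ℕ → ℝ)
    (hmin : 0 < liminf
      (fun k : ℕ => ((lamMin ((1 / (k : ℝ)) • information α φ k) : ℝ) : EReal)) atTop) :
    ∃ c > 0, ∀ᶠ k : ℕ in atTop, ‖WithLp.toLp 2 (θ - rlsTheta α θ₀ φ yb k)‖ ^ 2 ≤
      c / (k : ℝ) ^ 2 * ∑ j, (α • (θ - θ₀) -
        ∑ t ∈ Finset.range k, (yb (t + 1) - φ t ⬝ᵥ θ) • φ t) j ^ 2 := by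
  obtain ⟨c, hc0, hc⟩ := EReal.lt_iff_exists_real_btwn.mp hmin
  have hc0 : 0 < c := by exact_mod_cast hc0
  refine ⟨(c ^ 2)⁻¹, by positivity, ?_⟩
  filter_upwards [eventually_lt_of_lt_liminf hc, eventually_ge_atTop 1] with k hk hk1
  have hk0 : (0 : ℝ) < k := by exact_mod_cast hk1
  have hlt : c < lamMin ((1 / (k : ℝ)) • information α φ k) := by exact_mod_cast hk
  set x := θ - rlsTheta α θ₀ φ yb k with hx
  have hxx : 0 ≤ x ⬝ᵥ x := Finset.sum_nonneg fun i _ => mul_self_nonneg _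
  have h1 := (mul_le_mul_of_nonneg_right hlt.le hxx).trans
    (lamMin_mul_le (isHermitian_smul_information hα φ k (1 / (k : ℝ))) x)
  rw [Matrix.smul_mulVec, dotProduct_smul, smul_eq_mul, one_div, ← div_eq_inv_mul,
    le_div_iff₀ hk0, information_mulVec_error hα, mul_right_comm] at h1
  have h2 := dotProduct_self_le_of_mul_le (mul_pos hc0 hk0) h1
  have h3 : ‖WithLp.toLp 2 x‖ ^ 2 = x ⬝ᵥ x := by
    rw [EuclideanSpace.real_norm_sq_eq]
    simp [dotProduct, sq]
  rw [h3]
  refine h2.trans_eq ?_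
  simp only [dotProduct, ← sq]
  rw [mul_pow]
  field_simp

/-- Rates for the transforms of the two noises carry over to the estimation error. -/
theorem error_isBigO {α : ℝ} (hα : 0 < α) (θ θ₀ : ι → ℝ) (φ : ℕ → ι → ℝ) (yb v₁ v₂ : ℕ → ℝ)
    (hyb : ∀ t, yb (t + 1) = φ t ⬝ᵥ θ + v₁ t + v₂ t)
    (hmin : 0 < liminf
      (fun k : ℕ => ((lamMin ((1 / (k : ℝ)) • information α φ k) : ℝ) : EReal)) atTop)
    {ρ : ℕ → ℝ} (hρ : (fun _ : ℕ => (1 : ℝ)) =O[atTop] ρ)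
    (h₁ : ∀ j, (fun k => transform (fun t => φ t j) v₁ k ^ 2) =O[atTop] fun k => k * ρ k)
    (h₂ : ∀ j, (fun k => transform (fun t => φ t j) v₂ k ^ 2) =O[atTop] fun k => k * ρ k) :
    (fun k : ℕ => ‖WithLp.toLp 2 (θ - rlsTheta α θ₀ φ yb k)‖ ^ 2) =O[atTop]
      fun k => ρ k / k := by
  obtain ⟨c, hc, hev⟩ := eventually_error_le hα θ θ₀ φ yb hmin
  have hone : (fun _ : ℕ => (1 : ℝ)) =O[atTop] fun k : ℕ => k * ρ k := by
    have h : (fun _ : ℕ => (1 : ℝ)) =O[atTop] fun k : ℕ => (k : ℝ) := by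
      refine IsBigO.of_bound 1 ?_
      filter_upwards [eventually_ge_atTop 1] with k hk
      have : (1 : ℝ) ≤ k := by exact_mod_cast hk
      simpa using this
    simpa using h.mul hρ
  have hcoord : ∀ (j : ι) (k : ℕ), (α • (θ - θ₀) -
      ∑ t ∈ Finset.range k, (yb (t + 1) - φ t ⬝ᵥ θ) • φ t) j =
        α * (θ j - θ₀ j) - (transform (fun t => φ t j) v₁ k + transform (fun t => φ t j) v₂ k) := by
    intro j k
    simp only [Pi.sub_apply, Pi.smul_apply, smul_eq_mul, Finset.sum_apply, transform,
      ← Finset.sum_add_distrib]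
    congr 1
    refine Finset.sum_congr rfl fun t _ => ?_
    rw [hyb t]; ring
  have hsum : (fun k : ℕ => ∑ j, (α • (θ - θ₀) -
      ∑ t ∈ Finset.range k, (yb (t + 1) - φ t ⬝ᵥ θ) • φ t) j ^ 2) =O[atTop]
        fun k => k * ρ k := by
    refine IsBigO.fun_sum fun j _ => ?_
    have hb : (fun k : ℕ => 3 * ((α * (θ j - θ₀ j)) ^ 2 * 1 + transform (fun t => φ t j) v₁ k ^ 2 +
        transform (fun t => φ t j) v₂ k ^ 2)) =O[atTop] fun k => k * ρ k :=
      (((hone.const_mul_left _).add (h₁ j)).add (h₂ j)).const_mul_left 3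
    refine IsBigO.trans (IsBigO.of_bound 1 (Eventually.of_forall fun k => ?_)) hb
    rw [Real.norm_of_nonneg (sq_nonneg _), Real.norm_of_nonneg (by positivity), hcoord]
    nlinarith [sq_nonneg (α * (θ j - θ₀ j) + transform (fun t => φ t j) v₁ k),
      sq_nonneg (α * (θ j - θ₀ j) + transform (fun t => φ t j) v₂ k),
      sq_nonneg (transform (fun t => φ t j) v₁ k - transform (fun t => φ t j) v₂ k)]
  have hfac : (fun k : ℕ => c / (k : ℝ) ^ 2) =O[atTop] fun k : ℕ => ((k : ℝ) ^ 2)⁻¹ := by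
    simp only [div_eq_mul_inv]
    exact (isBigO_refl _ _).const_mul_left c
  refine (IsBigO.of_bound 1 ?_).trans ((hfac.mul hsum).congr' (EventuallyEq.refl _ _) ?_)
  · filter_upwards [hev] with k hk
    rw [Real.norm_of_nonneg (by positivity), one_mul]
    exact hk.trans (le_abs_self _)
  · filter_upwards [eventually_ge_atTop 1] with k hk
    have : (k : ℝ) ≠ 0 := by positivity
    field_simp

end algebra

/-! ### Rates -/

theorem transform_sq_isBigO {f v : ℕ → ℝ} {C₁ : ℝ}
    (hA : ∀ᶠ k : ℕ in atTop, energy f k ≤ C₁ * k) {H : ℝ → ℝ}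
    (hH0 : ∀ r, 1 ≤ r → 0 ≤ H r) (hH : ∀ r r', 1 ≤ r → r ≤ r' → H r ≤ H r') {C : ℝ}
    (hM : ∀ k, (transform f v k / √(energy f k)) ^ 2 ≤ C * H (Real.log (energy f k)))
    {ρ : ℕ → ℝ} (hρ : (fun k : ℕ => H (2 * Real.log k)) =O[atTop] ρ) :
    (fun k => transform f v k ^ 2) =O[atTop] fun k => k * ρ k := by
  have hbound : (fun k => transform f v k ^ 2) =O[atTop] fun k : ℕ => k * H (2 * Real.log k) := by
    refine IsBigO.of_bound (C₁ * |C|) ?_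
    obtain ⟨N, hN⟩ := exists_nat_ge C₁
    filter_upwards [hA, eventually_ge_atTop (max N 1)] with k hk hkN
    have hk1 : (1 : ℝ) ≤ k := by exact_mod_cast (le_max_right N 1).trans hkN
    have hkC : C₁ ≤ k := hN.trans (by exact_mod_cast (le_max_left N 1).trans hkN)
    have hA0 := energy_pos f k
    have hlog1 := one_le_log_energy f k
    -- Once k ≥ C₁, the energy is at most C₁ k ≤ k².
    have hlog : Real.log (energy f k) ≤ 2 * Real.log k := by
      rw [← Real.log_rpow (by linarith), Real.rpow_two]
      exact Real.log_le_log hA0 (hk.trans (by nlinarith))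
    have h1 := hH0 _ hlog1
    have h2 := hH _ _ hlog1 hlog
    have h3 : transform f v k ^ 2 = energy f k * (transform f v k / √(energy f k)) ^ 2 := by
      rw [div_pow, Real.sq_sqrt hA0.le]; field_simp
    rw [Real.norm_of_nonneg (sq_nonneg _),
      Real.norm_of_nonneg (mul_nonneg (by linarith) (h1.trans h2)), h3]
    have h4 : (transform f v k / √(energy f k)) ^ 2 ≤ |C| * H (2 * Real.log k) :=
      (hM k).trans ((mul_le_mul_of_nonneg_right (le_abs_self C) h1).trans
        (mul_le_mul_of_nonneg_left h2 (abs_nonneg C)))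
    calc energy f k * (transform f v k / √(energy f k)) ^ 2
        ≤ C₁ * k * (|C| * H (2 * Real.log k)) :=
          mul_le_mul hk h4 (sq_nonneg _) (hA0.le.trans hk)
      _ = _ := by ring
  exact hbound.trans ((isBigO_refl _ _).mul hρ)

theorem eventually_exp_one_le_log : ∀ᶠ k : ℕ in atTop, Real.exp 1 ≤ Real.log k :=
  (Real.tendsto_log_atTop.comp tendsto_natCast_atTop_atTop).eventually_ge_atTop _

theorem isBigO_one_log : (fun _ : ℕ => (1 : ℝ)) =O[atTop] fun k : ℕ => Real.log k := by
  refine IsBigO.of_bound 1 ?_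
  filter_upwards [eventually_exp_one_le_log] with k hk
  rw [one_mul, norm_one]
  exact ((Real.one_le_exp (by norm_num)).trans hk).trans (le_abs_self _)

theorem log_exp_one_add_two_mul_le {r : ℝ} (hr : 0 ≤ r) :
    Real.log (Real.exp 1 + 2 * r) ≤ 2 * Real.log (Real.exp 1 + r) := by
  have he := Real.add_one_le_exp 1
  rw [← Real.log_rpow (by positivity), Real.rpow_two]
  exact Real.log_le_log (by positivity) (by nlinarith)

theorem isBigO_growth_log {κ : ℝ} (hκ : 0 ≤ κ) :
    (fun k : ℕ => (Real.exp 1 + 2 * Real.log k) *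
      Real.log (Real.exp 1 + 2 * Real.log k) ^ κ) =O[atTop]
        fun k : ℕ => Real.log k * Real.log (Real.exp 1 + Real.log k) ^ κ := by
  refine IsBigO.of_bound (3 * 2 ^ κ) ?_
  filter_upwards [eventually_exp_one_le_log] with k hk
  have he := Real.exp_pos 1
  have h0 : 0 ≤ Real.log (k : ℝ) := he.le.trans hk
  have h1 := one_le_log_exp_one_add h0
  have h2 := one_le_log_exp_one_add (r := 2 * Real.log k) (by linarith)
  have h3 := Real.rpow_le_rpow (by linarith) (log_exp_one_add_two_mul_le h0) hκ
  rw [Real.mul_rpow (by norm_num) (by linarith)] at h3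
  rw [Real.norm_of_nonneg (by positivity), Real.norm_of_nonneg (by positivity)]
  calc _ ≤ (3 * Real.log k) * (2 ^ κ * Real.log (Real.exp 1 + Real.log k) ^ κ) :=
        mul_le_mul (by linarith) h3 (by positivity) (by positivity)
    _ = _ := by ring

theorem isBigO_one_log_mul {κ : ℝ} (hκ : 0 ≤ κ) : (fun _ : ℕ => (1 : ℝ)) =O[atTop]
    fun k : ℕ => Real.log k * Real.log (Real.exp 1 + Real.log k) ^ κ := by
  refine IsBigO.of_bound 1 ?_
  filter_upwards [eventually_exp_one_le_log] with k hk
  have h0 : 1 ≤ Real.log (k : ℝ) := (Real.one_le_exp (by norm_num)).trans hk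
  rw [one_mul, norm_one]
  exact (one_le_mul_of_one_le_of_one_le h0 (Real.one_le_rpow
    (one_le_log_exp_one_add (by linarith)) hκ)).trans (le_abs_self _)

theorem tendsto_log_rpow_div {s : ℝ} :
    Tendsto (fun k : ℕ => Real.log k ^ s / k) atTop (𝓝 0) := by
  have h := (isLittleO_log_rpow_rpow_atTop s one_pos).tendsto_div_nhds_zero
  simpa only [Real.rpow_one, Function.comp_def] using h.comp tendsto_natCast_atTop_atTop

theorem tendsto_log_mul_div {κ : ℝ} (hκ : 0 ≤ κ) : Tendsto
    (fun k : ℕ => Real.log k * Real.log (Real.exp 1 + Real.log k) ^ κ / k) atTop (𝓝 0) := by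
  have h := (tendsto_log_rpow_div (s := 1 + κ)).const_mul (2 ^ κ)
  rw [mul_zero] at h
  refine squeeze_zero' ?_ ?_ h
  · filter_upwards [eventually_exp_one_le_log] with k hk
    have h0 : 0 ≤ Real.log (k : ℝ) := (Real.exp_pos 1).le.trans hk
    have h1 := one_le_log_exp_one_add h0
    positivity
  · filter_upwards [eventually_exp_one_le_log] with k hk
    have h0 : 0 < Real.log (k : ℝ) := (Real.exp_pos 1).trans_le hk
    have h1 := one_le_log_exp_one_add h0.le
    have h2 : Real.log (Real.exp 1 + Real.log k) ≤ 2 * Real.log k := by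
      have := Real.log_le_sub_one_of_pos (show 0 < Real.exp 1 + Real.log k by positivity)
      linarith
    have h3 := Real.rpow_le_rpow (by linarith) h2 hκ
    rw [Real.mul_rpow (by norm_num) h0.le] at h3
    rw [Real.rpow_add h0, Real.rpow_one, ← mul_div_assoc]
    refine div_le_div_of_nonneg_right ?_ k.cast_nonneg
    calc _ ≤ Real.log k * (2 ^ κ * Real.log k ^ κ) := by gcongr
      _ = _ := by ring

theorem tendsto_of_norm_sub_sq {ι : Type*} [Fintype ι] {θ : ι → ℝ} {x : ℕ → ι → ℝ} {g : ℕ → ℝ}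
    (h : (fun k : ℕ => ‖WithLp.toLp 2 (θ - x k)‖ ^ 2) =O[atTop] g) (hg : Tendsto g atTop (𝓝 0)) :
    Tendsto x atTop (𝓝 θ) := by
  have h0 := h.trans_tendsto hg
  refine tendsto_pi_nhds.mpr fun j => ?_
  rw [tendsto_iff_norm_sub_tendsto_zero]
  have hs := h0.sqrt
  rw [Real.sqrt_zero] at hs
  refine squeeze_zero (fun k => norm_nonneg _) (fun k => ?_) hs
  rw [Real.sqrt_sq (norm_nonneg _), norm_sub_rev]
  exact PiLp.norm_apply_le (WithLp.toLp 2 (θ - x k)) j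

/-- Raising to the power 2/b turns the growth r^(b/2) into r, which is why moments above order 2
leave only one logarithm. -/
theorem sq_le_of_abs_rpow_le {b : ℝ} (hb : 2 < b) (C : ℝ) :
    ∃ C', ∀ x r : ℝ, 1 ≤ r → |x| ^ b ≤ C * r ^ (b / 2) → x ^ 2 ≤ C' * r := by
  refine ⟨|C| ^ (2 / b), fun x r hr h => ?_⟩
  have h1 : |x| ^ b ≤ |C| * r ^ (b / 2) :=
    h.trans (mul_le_mul_of_nonneg_right (le_abs_self C) (by positivity))
  have h2 := Real.rpow_le_rpow (by positivity) h1 (show 0 ≤ 2 / b by positivity)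
  rw [← Real.rpow_mul (abs_nonneg _), Real.mul_rpow (abs_nonneg _) (by positivity),
    ← Real.rpow_mul (by linarith), show b * (2 / b) = 2 by field_simp,
    show b / 2 * (2 / b) = 1 by field_simp, Real.rpow_one, Real.rpow_two, sq_abs] at h2
  exact h2

/-- The rate of the transforms of martingale difference noise for a given growth function `h`,
where `H` is the growth that `h` imposes on squares. -/
theorem MartingaleDifferenceNoise.ae_transform_sq_isBigO {Ω : Type*} [mΩ : MeasurableSpace Ω]
    {μ : Measure Ω} [IsProbabilityMeasure μ] {ℱ : Filtration ℕ mΩ} {w : ℕ → Ω → ℝ} {β : ℝ}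
    (hw : MartingaleDifferenceNoise μ ℱ w β) {f : ℕ → Ω → ℝ}
    (hf : ∀ n, Measurable[ℱ n] (f n)) {b : ℝ} (h2 : 2 ≤ b) (h4 : b ≤ 4) (hbβ : b ≤ β)
    {h G : ℝ → ℝ} (hG : IsGrowth h G)
    (hA : ∀ᵐ ω ∂μ, ∃ C, ∀ᶠ k : ℕ in atTop, energy (fun t => f t ω) k ≤ C * k) {H : ℝ → ℝ}
    (hH0 : ∀ r, 1 ≤ r → 0 ≤ H r) (hH : ∀ r r', 1 ≤ r → r ≤ r' → H r ≤ H r')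
    (hsq : ∀ C, ∃ C', ∀ x r : ℝ, 1 ≤ r → |x| ^ b ≤ C * h r → x ^ 2 ≤ C' * H r)
    {ρ : ℕ → ℝ} (hρ : (fun k : ℕ => H (2 * Real.log k)) =O[atTop] ρ) :
    ∀ᵐ ω ∂μ, (fun k => transform (fun t => f t ω) (fun t => w (t + 1) ω) k ^ 2) =O[atTop]
      fun k => k * ρ k := by
  filter_upwards [hw.ae_exists_normalized_le hf h2 h4 hbβ hG, hA] with ω ⟨C, hC⟩ ⟨C₁, hC₁⟩
  obtain ⟨C', hC'⟩ := hsq C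
  exact transform_sq_isBigO hC₁ hH0 hH (fun k => hC' _ _ (one_le_log_energy _ k) (hC k)) hρ

theorem regressor_eq_phiBar {m : ℕ} {q : Fin m → ℕ} (y y' η : ℕ → ℝ) (u ξ : Fin m → ℕ → ℝ)
    (hξ : ∀ i k, ξ i k = 0) (k : ℕ) : phiBar 0 q y η u ξ k = regressor 0 q y' u k := by
  have h : uBar u ξ = u := by
    funext i k
    rw [uBar, hξ, add_zero]
  rw [phiBar, h]
  exact regressor_zero_congr _ _ _ _

end MPARX

end

/-! ### The main theorem -/

open MPARX in
theorem corollary2 {Ω : Type*} [mΩ : MeasurableSpace Ω] (μ : Measure Ω) [IsProbabilityMeasure μ]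
    -- orders and true parameter of the system
    {p m : ℕ} {q : Fin m → ℕ} (θ : Idx p q → ℝ)
    -- output, inputs, system noise, added noises
    (y : ℕ → Ω → ℝ) (u : Fin m → ℕ → Ω → ℝ) (w : ℕ → Ω → ℝ)
    (η : ℕ → Ω → ℝ) (ξ : Fin m → ℕ → Ω → ℝ)
    (hu : ∀ i k, Measurable (u i k))
    -- the system
    (hy_zero : ∀ ω, y 0 ω = 0)
    (hy : ∀ k ω, y (k + 1) ω =
      θ ⬝ᵥ regressor p q (fun t => y t ω) (fun i t => u i t ω) k + w (k + 1) ω)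
    -- no regression term, no noise on the inputs, Laplace noise on the output
    (hp : p = 0) (hξ : ∀ i k ω, ξ i k ω = 0)
    (b₀ : ℝ) (hb₀ : 0 < b₀) (hη : ∀ k, HasLaw (η (k + 1)) (laplace 0 b₀) μ)
    -- standing assumptions
    (hstable : AsymptoticallyStable fun j => θ (Sum.inl j))
    (hnoise : IndependentNoise μ η ξ y u w)
    (ℱ : Filtration ℕ mΩ) (β : ℝ) (hβ : 2 ≤ β)
    (hw : MartingaleDifferenceNoise μ ℱ w β)
    (hφ : ∀ k, Measurable[ℱ k] fun ω =>
      regressor p q (fun t => y t ω) (fun i t => u i t ω) k)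
    -- choice of the scale of the output noise
    (δ ε : ℝ) (hδ : 0 < δ) (hε : 0 < ε)
    (c₀ lam : ℝ) (hc₀ : 0 < c₀) (hlam : lam ∈ Set.Ioo (0 : ℝ) 1)
    (hcomp : ∀ k : ℕ, opNorm (companion (fun j => θ (Sum.inl j)) ^ k) ≤ c₀ * lam ^ k)
    (hscale : (1 + √(p : ℝ) * c₀ * lam / (1 - lam)) / b₀ * δ ≤ ε)
    -- the algorithm: perturbed regressors, matrices, estimates
    (α : ℝ) (hα : 0 < α) (θ₀ : Idx p q → ℝ)
    (φb : Ω → ℕ → Idx p q → ℝ)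
    (hφb : ∀ ω k, φb ω k =
      phiBar p q (fun t => y t ω) (fun t => η t ω) (fun i t => u i t ω) (fun i t => ξ i t ω) k)
    (P : Ω → ℕ → Matrix (Idx p q) (Idx p q) ℝ) (hP : ∀ ω k, P ω k = rlsP α (φb ω) k)
    (θhat : Ω → ℕ → Idx p q → ℝ)
    (hθhat : ∀ ω k, θhat ω k =
      rlsTheta α θ₀ (φb ω) (yBar (fun t => y t ω) (fun t => η t ω)) k)
    -- excitation
    (κ γ₂ : ℝ) (hκ : 1 < κ) (hγ₂ : 0 < γ₂)
    (hexc : ∀ᵐ ω ∂μ,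
      0 < liminf (fun k : ℕ => ((lamMin ((1 / (k : ℝ)) • (P ω k)⁻¹) : ℝ) : EReal)) atTop ∧
      limsup (fun k : ℕ => ((lamMax ((1 / (k : ℝ)) • (P ω k)⁻¹) : ℝ) : EReal)) atTop < (γ₂ : EReal)) :
    PrivateForOutput μ θ u w η ε δ ∧
    (∀ᵐ ω ∂μ, Tendsto (θhat ω) atTop (𝓝 θ)) ∧
    (β = 2 → ∀ᵐ ω ∂μ,
      (fun k : ℕ => ‖WithLp.toLp 2 (θ - θhat ω k)‖ ^ 2) =O[atTop]
        fun k : ℕ => Real.log k * Real.log (Real.exp 1 + Real.log k) ^ κ / k) ∧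
    (2 < β → ∀ᵐ ω ∂μ,
      (fun k : ℕ => ‖WithLp.toLp 2 (θ - θhat ω k)‖ ^ 2) =O[atTop]
        fun k : ℕ => Real.log k / k) := by
  subst hp
  have hreg : ∀ ω k, φb ω k = regressor 0 q (fun t => y t ω) (fun i t => u i t ω) k := fun ω k => by
    rw [hφb]; exact regressor_eq_phiBar _ _ _ _ _ (fun i k => hξ i k ω) k
  have mw : ∀ k, Measurable (w (k + 1)) := fun k => (hw.adapted k).mono (ℱ.le _) le_rfl
  have my : ∀ k, Measurable (y k) := fun k => by
    rcases k with _ | k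
    · rw [show y 0 = fun _ => 0 from funext hy_zero]; exact measurable_const
    · rw [show y (k + 1) = _ from funext (hy k)]
      refine Measurable.add (Finset.measurable_sum _ fun j _ => ?_) (mw k)
      exact (measurable_pi_iff.mp ((hφ k).mono (ℱ.le _) le_rfl) j).const_mul _
  have hsys : systemSigma y u w ≤ mΩ := systemSigma_le y u w my hu mw
  have mf : ∀ j k, Measurable[ℱ k] fun ω => φb ω k j := fun j k => by
    simp only [hreg]
    exact (measurable_pi_apply j).comp (hφ k)
  -- For the added noise the regressor is measurable at every stage, because its coordinates are
  -- inputs and belong to the system σ-algebra.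
  have mf' : ∀ j k, Measurable[noiseFiltration hnoise.measurable hsys k] fun ω => φb ω k j :=
    fun j k => by
      simp only [hreg]
      exact (measurable_regressor_systemSigma y u w _ k j).mono le_sup_left le_rfl
  have hη' := hnoise.martingaleDifferenceNoise hsys hb₀ hη (show 0 ≤ β by linarith)
  simp only [hP, inv_rlsP hα] at hexc
  have hA : ∀ j, ∀ᵐ ω ∂μ, ∃ C, ∀ᶠ k : ℕ in atTop, energy (fun t => φb ω t j) k ≤ C * k :=
    fun j => hexc.mono fun ω hω => eventually_energy_le hα (φb ω) hω.2 j
  have rate : ∀ (b : ℝ) (h G H : ℝ → ℝ) (ρ : ℕ → ℝ), 2 ≤ b → b ≤ 4 → b ≤ β → IsGrowth h G →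
      (∀ r, 1 ≤ r → 0 ≤ H r) → (∀ r r', 1 ≤ r → r ≤ r' → H r ≤ H r') →
      (∀ C, ∃ C', ∀ x r : ℝ, 1 ≤ r → |x| ^ b ≤ C * h r → x ^ 2 ≤ C' * H r) →
      (fun k : ℕ => H (2 * Real.log k)) =O[atTop] ρ → (fun _ : ℕ => (1 : ℝ)) =O[atTop] ρ →
      ∀ᵐ ω ∂μ, (fun k : ℕ => ‖WithLp.toLp 2 (θ - θhat ω k)‖ ^ 2) =O[atTop]
        fun k : ℕ => ρ k / k := by
    intro b h G H ρ h2 h4 hbβ hG hH0 hH hsq hHρ hρ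
    have r1 := ae_all_iff.mpr fun j =>
      hw.ae_transform_sq_isBigO (mf j) h2 h4 hbβ hG (hA j) hH0 hH hsq hHρ
    have r2 := ae_all_iff.mpr fun j =>
      hη'.ae_transform_sq_isBigO (mf' j) h2 h4 hbβ hG (hA j) hH0 hH hsq hHρ
    filter_upwards [hexc, r1, r2] with ω hω h1 h2
    simp only [hθhat]
    refine error_isBigO hα θ θ₀ (φb ω) _ (fun t => w (t + 1) ω) (fun t => η (t + 1) ω)
      (fun t => ?_) hω.1 hρ h1 h2
    rw [hreg, dotProduct_comm, yBar, hy]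
  -- Order 2 is available for every β ≥ 2, so this rate also gives consistency when β > 2.
  have rate_two : ∀ᵐ ω ∂μ, (fun k : ℕ => ‖WithLp.toLp 2 (θ - θhat ω k)‖ ^ 2) =O[atTop]
      fun k : ℕ => Real.log k * Real.log (Real.exp 1 + Real.log k) ^ κ / k := by
    have hg := isGrowth_mul_log_rpow hκ
    refine rate 2 _ _ _ _ le_rfl (by norm_num) hβ hg
      (fun r hr => zero_le_one.trans (hg.one_le r hr)) hg.mono (fun C => ⟨C, fun x r _ h => ?_⟩)
      (isBigO_growth_log (by linarith)) (isBigO_one_log_mul (by linarith))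
    rwa [Real.rpow_two, sq_abs] at h
  refine ⟨hnoise.privateForOutput θ hsys hb₀ hη ?_, ?_, fun _ => rate_two, fun hβ2 => ?_⟩
  · simpa [div_eq_mul_inv, mul_comm] using hscale
  · filter_upwards [rate_two] with ω hω
    exact tendsto_of_norm_sub_sq hω (tendsto_log_mul_div (by linarith))
  -- Any order in (2, 4] suffices for the rate; capping at 4 meets the range of the scalar
  -- inequalities.
  · have hb : 2 < min β 4 := lt_min hβ2 (by norm_num)
    refine rate (min β 4) _ _ (fun r => r) _ hb.le (min_le_right _ _) (min_le_left _ _)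
      (isGrowth_rpow (s := min β 4 / 2) (by linarith)) (fun r hr => by linarith)
      (fun r r' _ h => h) (sq_le_of_abs_rpow_le hb) ?_ isBigO_one_log
    exact (isBigO_refl _ _).const_mul_left 2
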